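/- Let $K$ be an algebraically closed field of characteristic $3$, let $A=(a_{ij})_{1\le i,j\le n}$ be the Cartan matrix of type $F_4$, $E_6$, $E_7$ or $E_8$, and let $\mathfrak g=\mathfrak g(A)$ be the contragredient Lie algebra of $A$ over $K$: the quotient of the Lie algebra $\widetilde{\mathfrak g}(A)$ with generators $e_i,f_i,h_i$ and relations $$[h_i,h_j]=0,\quad [e_i,f_j]=\delta_{ij}h_i,\quad [h_i,e_j]=a_{ij}e_j,\quad [h_i,f_j]=-a_{ij}f_j$$ by its largest $\mathbb Z^n$-graded ideal meeting $\operatorname{span}(h_1,\dots,h_n)$ trivially (here $e_i$, $f_i$, $h_i$ have degrees $\alpha_i$, $-\alpha_i$, $0$, where $\alpha_1,\dots,\alpha_n$ is the standard basis of $\mathbb Z^n$). Let $I$ be a set of pairwise non-adjacent nodes of the Dynkin diagram (the *black* nodes; all other nodes are *white*), and put $e_I=\sum_{i\in I}e_i$. A *legal swap* exchanges the colors of a black node $i$ and a white node $j$ that are connected by a single edge, provided that no node adjacent to $j$ other than $i$ is black. Legal swaps generate a groupoid, whose elements are called *legal recolorings*; $\sigma(I)$ denotes the set of black nodes after applying the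 legal recoloring $\sigma$ to $I$. For a derivation $d$ of a finite-dimensional Lie algebra $L$ over $K$ with $d^3=0$, view $L$ as a Lie algebra in the symmetric tensor category $\operatorname{Rep}\alpha_3$ of finite-dimensional $K[t]/(t^3)$-modules ($t$ primitive), with $t$ acting by $d$. Its semisimplification $\overline{L}$ is the image of $L$ in the quotient of $\operatorname{Rep}\alpha_3$ by the negligible morphisms, i.e. the morphisms $\varphi:X\to Y$ with $\operatorname{tr}(\psi\varphi)=0$ for all morphisms $\psi:Y\to X$. This quotient is the category of supervector spaces, so $\overline L$ is a Lie superalgebra (in the operadic sense: a Lie algebra in supervector spaces). Explicitly, $\overline L_{\bar 0}$ and $\overline L_{\bar 1}$ are the spaces of morphisms $J_1\to L$ and $J_2\to L$ modulo negligible ones, where $J_m$ is the Jordan block $v_1\mapsto\cdots\mapsto v_m\mapsto 0$, and the bracket is induced by that of $L$ through $J_1\otimes J_m=J_m$ and the split inclusion $J_1\to J_2\otimes J_2$, $1\mapsto -v_1\otimes v_2+v_2\otimes v_1$. **Theorem.** For every such $I$ and every legal recoloring $\sigma$ of $I$: 1. $\mathfrak g$ is finite-dimensional and $(\operatorname{ad}e_I)^3=(\operatorname{ad}e_{\sigma(I)})^3=0$,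 so that $\mathfrak g$ is a Lie algebra in $\operatorname{Rep}\alpha_3$ in two ways: $\mathfrak g_I$, with $t$ acting by $\operatorname{ad}e_I$, and $\mathfrak g_{\sigma(I)}$, with $t$ acting by $\operatorname{ad}e_{\sigma(I)}$. 2. The semisimplifications $\overline{\mathfrak g_I}$ and $\overline{\mathfrak g_{\sigma(I)}}$ are isomorphic as Lie superalgebras. 3. $e_I$ and $e_{\sigma(I)}$ are conjugate under the adjoint group of $\mathfrak g$, i.e. the group of automorphisms of $\mathfrak g$ generated by $\exp(t\operatorname{ad}e_i)=1+t\operatorname{ad}e_i+\tfrac{t^2}{2}(\operatorname{ad}e_i)^2$ and $\exp(t\operatorname{ad}f_i)=1+t\operatorname{ad}f_i+\tfrac{t^2}{2}(\operatorname{ad}f_i)^2$ for $t\in K$, $1\le i\le n$. -/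

import Mathlib

/-!
# Semisimplification of exceptional Lie algebras in characteristic three

* contragredient Lie algebras `g(A)`;
* Lie algebras in `Rep α₃` and their semisimplification, an (operadic) Lie superalgebra;
* independent sets of nodes of a Dynkin diagram and their legal recolorings;
* the adjoint group.
-/

noncomputable section

namespace ExcLie

/-! ## Contragredient Lie algebras -/

section Contragredient

variable (K : Type*) [Field K] {n : ℕ} (A : Matrix (Fin n) (Fin n) ℤ)

open CartanMatrix

/-- The defining relations `[hᵢ, hⱼ] = 0`, `[eᵢ, fⱼ] = δᵢⱼ hᵢ`, `[hᵢ, eⱼ] = aᵢⱼ eⱼ`,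
`[hᵢ, fⱼ] = -aᵢⱼ fⱼ` of the Lie algebra `g̃(A)`, inside the free Lie algebra on the symbols
`hᵢ, eᵢ, fᵢ`. (No Serre relations.) -/
def tildeRelations : Set (FreeLieAlgebra K (Generators (Fin n))) :=
  Set.range (Relations.HH K) ∪ Set.range (Relations.EF K) ∪
    Set.range (Relations.HE K A) ∪ Set.range (Relations.HF K A)

/-- The Lie algebra `g̃(A)` attached to an integer matrix `A` which is nonsingular over `ℚ`
(so that the Cartan subalgebra has basis `h₁, …, hₙ`). -/
abbrev GTilde : Type _ :=
  FreeLieAlgebra K (Generators (Fin n)) ⧸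
    LieSubmodule.lieSpan K (FreeLieAlgebra K (Generators (Fin n))) (tildeRelations K A)

/-- The image in `g̃(A)` of a generator `hᵢ`, `eᵢ` or `fᵢ`. -/
def tildeGen (x : Generators (Fin n)) : GTilde K A :=
  LieSubmodule.Quotient.mk (FreeLieAlgebra.of K x)

/-- The Cartan subalgebra of `g̃(A)`: the span of the `hᵢ`. -/
def tildeCartan : Submodule K (GTilde K A) :=
  Submodule.span K (Set.range fun i => tildeGen K A (Generators.H i))

/-- `TildeHom K A α x`: the element `x` of `g̃(A)` is homogeneous of degree
`α ∈ Q = ⨁ ℤ αᵢ` for the grading with `deg eᵢ = αᵢ`, `deg fᵢ = -αᵢ`, `deg hᵢ = 0`. -/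
inductive TildeHom : (Fin n → ℤ) → GTilde K A → Prop
  | h (i : Fin n) : TildeHom 0 (tildeGen K A (Generators.H i))
  | e (i : Fin n) : TildeHom (Pi.single i 1) (tildeGen K A (Generators.E i))
  | f (i : Fin n) : TildeHom (-Pi.single i 1) (tildeGen K A (Generators.F i))
  | zero (α : Fin n → ℤ) : TildeHom α 0
  | add {α : Fin n → ℤ} {x y : GTilde K A} :
      TildeHom α x → TildeHom α y → TildeHom α (x + y)
  | smul {α : Fin n → ℤ} (c : K) {x : GTilde K A} : TildeHom α x → TildeHom α (c • x)
  | lie {α β : Fin n → ℤ} {x y : GTilde K A} :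
      TildeHom α x → TildeHom β y → TildeHom (α + β) ⁅x, y⁆

/-- A `Q`-graded ideal of `g̃(A)`: every element is a combination of homogeneous elements
of the ideal. -/
def IsGradedIdeal (I : LieIdeal K (GTilde K A)) : Prop :=
  ∀ x ∈ I, x ∈ Submodule.span K {y : GTilde K A | y ∈ I ∧ ∃ α, TildeHom K A α y}

/-- The ideal `r` of `g̃(A)`: the largest graded ideal that meets the Cartan subalgebra trivially,
i.e. the sum of all of them. -/
def maximalIdeal : LieIdeal K (GTilde K A) :=
  sSup {I : LieIdeal K (GTilde K A) |
    IsGradedIdeal K A I ∧ ∀ x ∈ I, x ∈ tildeCartan K A → x = 0}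

/-- The contragredient Lie algebra `g(A) = g̃(A) / r`. -/
abbrev Contragredient : Type _ := GTilde K A ⧸ maximalIdeal K A

/-- The Chevalley generator `eᵢ` of `g(A)`. -/
def e (i : Fin n) : Contragredient K A :=
  LieSubmodule.Quotient.mk (tildeGen K A (Generators.E i))

/-- The Chevalley generator `fᵢ` of `g(A)`. -/
def f (i : Fin n) : Contragredient K A :=
  LieSubmodule.Quotient.mk (tildeGen K A (Generators.F i))

/-- The element `e_I = ∑_{i ∈ I} eᵢ`. -/
def eSum (I : Finset (Fin n)) : Contragredient K A := ∑ i ∈ I, e K A i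

/-- The adjoint group of `g(A)`, as a subgroup of `GL(g(A))`. It is generated by the one-parameter
groups `exp (t ad eᵢ)` and `exp (t ad fᵢ)`, `t ∈ K`. For the algebras of type
`F₄`, `E₆`, `E₇`, `E₈` one has `(ad eᵢ)³ = (ad fᵢ)³ = 0` in characteristic three
(and `(ad eᵢ)³ / 3! = (ad fᵢ)³ / 3! = 0` on the Chevalley `ℤ`-form),
so that `exp (t ad x) = 1 + t ad x + (t² / 2) (ad x)²` for these `x`. -/
def adjointGroup : Subgroup (Contragredient K A ≃ₗ[K] Contragredient K A) :=
  Subgroup.closure {φ | ∃ (i : Fin n) (t : K) (x : Contragredient K A),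
    (x = e K A i ∨ x = f K A i) ∧
      ∀ y, φ y = y + t • ⁅x, y⁆ + (t ^ 2 / 2) • ⁅x, ⁅x, y⁆⁆}

end Contragredient

/-! ## Dynkin diagrams, configurations of black nodes, legal recolorings -/

section Diagram

/-- The Cartan matrices of the exceptional types `F₄`, `E₆`, `E₇`, `E₈`. -/
inductive IsExceptional : ∀ {n : ℕ}, Matrix (Fin n) (Fin n) ℤ → Prop
  | F₄ : IsExceptional CartanMatrix.F₄
  | E₆ : IsExceptional CartanMatrix.E₆
  | E₇ : IsExceptional CartanMatrix.E₇
  | E₈ : IsExceptional CartanMatrix.E₈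

variable {n : ℕ} (A : Matrix (Fin n) (Fin n) ℤ)

/-- Two nodes of the Dynkin diagram are adjacent (by an edge of any multiplicity). -/
def Adjacent (i j : Fin n) : Prop := i ≠ j ∧ A i j ≠ 0

/-- Two nodes of the Dynkin diagram are connected by a single edge. -/
def SingleEdge (i j : Fin n) : Prop := A i j = -1 ∧ A j i = -1

/-- The black nodes are pairwise non-adjacent. -/
def Independent (I : Finset (Fin n)) : Prop := ∀ i ∈ I, ∀ j ∈ I, ¬ Adjacent A i j

/-- `J` arises from the configuration `I` of black nodes by a legal swap: for a black node `i` and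
a white node `j` connected by a single edge, such that `i` is the only black node adjacent to `j`,
the colors of `i` and `j` are exchanged. -/
def LegalSwap (I J : Finset (Fin n)) : Prop :=
  Independent A I ∧ ∃ i ∈ I, ∃ j ∉ I, SingleEdge A i j ∧
    (∀ k ∈ I, Adjacent A k j → k = i) ∧ J = insert j (I.erase i)

/-- `J = σ(I)` for a legal recoloring `σ`, i.e. for an element of the groupoid generated by the
legal swaps (a composite of legal swaps and inverses of legal swaps). -/
def LegalRecoloring : Finset (Fin n) → Finset (Fin n) → Prop :=
  Relation.EqvGen (LegalSwap A)

end Diagram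

/-! ## Lie superalgebras -/

/-- An (operadic) Lie superalgebra, i.e. a Lie algebra in the symmetric category of super vector
spaces. The bracket of an odd element `x` with an even element `a` is `[x, a] = -[a, x]`. -/
structure LieSuperalgebra.{v, u} (K : Type u) [Field K] where
  /-- the even part -/
  even : Type v
  /-- the odd part -/
  odd : Type v
  [evenAddCommGroup : AddCommGroup even]
  [oddAddCommGroup : AddCommGroup odd]
  [evenModule : Module K even]
  [oddModule : Module K odd]
  /-- bracket of two even elements -/
  b00 : even →ₗ[K] even →ₗ[K] even
  /-- bracket of an even and an odd element -/
  b01 : even →ₗ[K] odd →ₗ[K] odd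
  /-- bracket of two odd elements -/
  b11 : odd →ₗ[K] odd →ₗ[K] even
  skew00 : ∀ a b, b00 a b = -b00 b a
  symm11 : ∀ x y, b11 x y = b11 y x
  jacobi000 : ∀ a b c, b00 a (b00 b c) = b00 (b00 a b) c + b00 b (b00 a c)
  jacobi001 : ∀ a b x, b01 a (b01 b x) = b01 (b00 a b) x + b01 b (b01 a x)
  jacobi011 : ∀ a x y, b00 a (b11 x y) = b11 (b01 a x) y + b11 x (b01 a y)
  jacobi111 : ∀ x y z, b01 (b11 x y) z + b01 (b11 y z) x + b01 (b11 z x) y = 0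

attribute [instance] LieSuperalgebra.evenAddCommGroup LieSuperalgebra.oddAddCommGroup
  LieSuperalgebra.evenModule LieSuperalgebra.oddModule

/-- An isomorphism of Lie superalgebras: an even linear isomorphism compatible with the brackets. -/
structure LieSuperalgebra.Iso {K : Type*} [Field K] (S T : LieSuperalgebra K) where
  /-- the isomorphism of the even parts -/
  evenEquiv : S.even ≃ₗ[K] T.even
  /-- the isomorphism of the odd parts -/
  oddEquiv : S.odd ≃ₗ[K] T.odd
  map_b00 : ∀ a b, evenEquiv (S.b00 a b) = T.b00 (evenEquiv a) (evenEquiv b)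
  map_b01 : ∀ a x, oddEquiv (S.b01 a x) = T.b01 (evenEquiv a) (oddEquiv x)
  map_b11 : ∀ x y, evenEquiv (S.b11 x y) = T.b11 (oddEquiv x) (oddEquiv y)

/-! ## Morphisms in `Rep α_p` modulo negligible morphisms -/

section Hom

variable {K V W : Type*} [Field K] [AddCommGroup V] [Module K V] [AddCommGroup W] [Module K W]

/-- Morphisms `(V, s) → (W, t)` of vector spaces with an endomorphism, i.e. of
`K[t]`-modules. -/
def repHom (s : Module.End K V) (t : Module.End K W) : Submodule K (V →ₗ[K] W) where
  carrier := {φ | φ ∘ₗ s = t ∘ₗ φ}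
  add_mem' {a b} ha hb := by
    simp only [Set.mem_ofPred_eq, LinearMap.add_comp, LinearMap.comp_add] at *
    rw [ha, hb]
  zero_mem' := by simp
  smul_mem' c x hx := by
    simp only [Set.mem_ofPred_eq, LinearMap.smul_comp, LinearMap.comp_smul] at *
    rw [hx]

/-- The negligible morphisms `φ : (V, s) → (W, t)`: those with `tr (ψ ∘ φ) = 0` for all morphisms
`ψ : (W, t) → (V, s)`. -/
def negligible (s : Module.End K V) (t : Module.End K W) : Submodule K (repHom s t) where
  carrier := {φ | ∀ ψ ∈ repHom t s, LinearMap.trace K V (ψ ∘ₗ φ.1) = 0}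
  add_mem' {a b} ha hb ψ hψ := by
    have h1 := ha ψ hψ
    have h2 := hb ψ hψ
    simp [LinearMap.comp_add, h1, h2]
  zero_mem' ψ _ := by simp
  smul_mem' c x hx ψ hψ := by
    have h1 := hx ψ hψ
    simp [LinearMap.comp_smul, h1]

/-- Morphisms in the semisimplification: morphisms modulo negligible morphisms. -/
abbrev ssHom (s : Module.End K V) (t : Module.End K W) : Type _ := repHom s t ⧸ negligible s t

variable (K) in
/-- The indecomposable object `J_n`: the space `Kⁿ` with the nilpotent Jordan block
`v₁ ↦ v₂ ↦ ⋯ ↦ vₙ ↦ 0`. -/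
def jordan (n : ℕ) : Module.End K (Fin n → K) :=
  Matrix.toLin' (Matrix.of fun i j : Fin n => if (i : ℕ) = (j : ℕ) + 1 then (1 : K) else 0)

end Hom

section BilinearLift

variable {K M N P : Type*} [Field K] [AddCommGroup M] [Module K M] [AddCommGroup N] [Module K N]
  [AddCommGroup P] [Module K P]

/-- The bilinear map on quotients induced by a bilinear map. -/
def quotLift₂ (M' : Submodule K M) (N' : Submodule K N) (b : M →ₗ[K] N →ₗ[K] P)
    (hM : ∀ x ∈ M', ∀ y, b x y = 0) (hN : ∀ x, ∀ y ∈ N', b x y = 0) :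
    (M ⧸ M') →ₗ[K] (N ⧸ N') →ₗ[K] P :=
  M'.liftQ
    { toFun := fun x => N'.liftQ (b x) (fun y hy => hN x y hy)
      map_add' := fun x x' => by
        apply Submodule.linearMap_qext
        ext y
        exact LinearMap.congr_fun (map_add b x x') y
      map_smul' := fun c x => by
        apply Submodule.linearMap_qext
        ext y
        exact LinearMap.congr_fun (map_smul b c x) y }
    (fun x hx => by
      rw [LinearMap.mem_ker]
      apply Submodule.linearMap_qext
      ext y
      exact hM x hx y)

@[simp] theorem quotLift₂_mk (M' : Submodule K M) (N' : Submodule K N) (b : M →ₗ[K] N →ₗ[K] P)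
    (hM : ∀ x ∈ M', ∀ y, b x y = 0) (hN : ∀ x, ∀ y ∈ N', b x y = 0) (x : M) (y : N) :
    quotLift₂ M' N' b hM hN (Submodule.Quotient.mk x) (Submodule.Quotient.mk y) = b x y := rfl

end BilinearLift

/-! ## Semisimplification of a Lie algebra in `Rep α₃` -/

section Semisimplification

variable {K L : Type*} [Field K] [LieRing L] [LieAlgebra K L] (d : LieDerivation K L L)

/-- `(L, d)` is a Lie algebra in `Rep α₃`, the category of finite-dimensional representations of
`K[t]/(t³)`, the generator `t` acting by the derivation `d`. -/
structure IsInRepAlpha3 : Prop where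
  finite : Module.Finite K L
  cube_eq_zero : (d : L →ₗ[K] L) ^ 3 = 0

/-- `Hom(J₁, L)`. -/
abbrev EvenHom : Submodule K ((Fin 1 → K) →ₗ[K] L) := repHom (jordan K 1) (d : L →ₗ[K] L)

/-- `Hom(J₂, L)`. -/
abbrev OddHom : Submodule K ((Fin 2 → K) →ₗ[K] L) := repHom (jordan K 2) (d : L →ₗ[K] L)

/-- The value of a morphism `J₁ → L` at the basis vector of `J₁`. -/
def EvenHom.v (φ : EvenHom d) : L := φ.1 (Pi.single 0 1)

/-- The value of a morphism `J₂ → L` at the first basis vector `v₁` of `J₂ = (v₁ ↦ v₂)`. -/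
def OddHom.v₁ (φ : OddHom d) : L := φ.1 (Pi.single 0 1)

/-- The value of a morphism `J₂ → L` at the second basis vector `v₂` of `J₂ = (v₁ ↦ v₂)`. -/
def OddHom.v₂ (φ : OddHom d) : L := φ.1 (Pi.single 1 1)

theorem jordan_one : jordan K 1 = 0 := by
  ext i j
  fin_cases i
  fin_cases j
  simp [jordan]

theorem jordan_two_apply (v : Fin 2 → K) : jordan K 2 v = ![0, v 0] := by
  ext j
  fin_cases j <;> simp [jordan, Matrix.mulVec, dotProduct]

theorem EvenHom.d_v (φ : EvenHom d) : d (EvenHom.v d φ) = 0 := by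
  have h := LinearMap.congr_fun φ.2 (Pi.single 0 1)
  simp [jordan_one] at h
  exact h.symm

theorem OddHom.d_v₁ (φ : OddHom d) : d (OddHom.v₁ d φ) = OddHom.v₂ d φ := by
  have h := LinearMap.congr_fun φ.2 (Pi.single 0 1)
  simp only [LinearMap.comp_apply, jordan_two_apply] at h
  rw [OddHom.v₁, OddHom.v₂]
  refine h.symm.trans (congrArg φ.1 ?_)
  ext j
  fin_cases j <;> simp

theorem OddHom.d_v₂ (φ : OddHom d) : d (OddHom.v₂ d φ) = 0 := by
  have h := LinearMap.congr_fun φ.2 (Pi.single 1 1)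
  simp only [LinearMap.comp_apply, jordan_two_apply] at h
  rw [OddHom.v₂]
  refine h.symm.trans ?_
  have : (![0, (Pi.single 1 1 : Fin 2 → K) 0] : Fin 2 → K) = 0 := by
    ext j
    fin_cases j <;> simp
  rw [this, map_zero]

theorem EvenHom.apply (φ : EvenHom d) (c : Fin 1 → K) : φ.1 c = c 0 • EvenHom.v d φ := by
  rw [EvenHom.v, ← map_smul]
  congr 1
  ext j
  fin_cases j
  simp

theorem OddHom.apply (φ : OddHom d) (c : Fin 2 → K) :
    φ.1 c = c 0 • OddHom.v₁ d φ + c 1 • OddHom.v₂ d φ := by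
  rw [OddHom.v₁, OddHom.v₂, ← map_smul, ← map_smul, ← map_add]
  congr 1
  ext j
  fin_cases j <;> simp

theorem EvenHom.ext_v {φ ψ : EvenHom d} (h : EvenHom.v d φ = EvenHom.v d ψ) : φ = ψ := by
  apply Subtype.ext
  apply LinearMap.ext
  intro c
  rw [EvenHom.apply, EvenHom.apply, h]

theorem OddHom.ext_v {φ ψ : OddHom d} (h : OddHom.v₁ d φ = OddHom.v₁ d ψ) : φ = ψ := by
  apply Subtype.ext
  apply LinearMap.ext
  intro c
  rw [OddHom.apply, OddHom.apply, ← OddHom.d_v₁, ← OddHom.d_v₁, h]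

/-- The morphism `J₁ → L` with value `x` at the basis vector. -/
def evenMk (x : L) (hx : d x = 0) : EvenHom d :=
  ⟨(LinearMap.proj 0 : (Fin 1 → K) →ₗ[K] K).smulRight x, by
    change _ = _
    rw [jordan_one]
    ext c
    simp [hx]⟩

@[simp] theorem evenMk_v (x : L) (hx : d x = 0) : EvenHom.v d (evenMk d x hx) = x := by
  simp [EvenHom.v, evenMk]

/-- The morphism `J₂ → L` with values `x` and `d x` at the basis vectors. -/
def oddMk (x : L) (hx : d (d x) = 0) : OddHom d :=
  ⟨(LinearMap.proj 0 : (Fin 2 → K) →ₗ[K] K).smulRight x +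
    (LinearMap.proj 1 : (Fin 2 → K) →ₗ[K] K).smulRight (d x), by
    change _ = _
    apply LinearMap.ext
    intro c
    simp [jordan_two_apply, hx]⟩

@[simp] theorem oddMk_v₁ (x : L) (hx : d (d x) = 0) : OddHom.v₁ d (oddMk d x hx) = x := by
  simp [OddHom.v₁, oddMk]

@[simp] theorem oddMk_v₂ (x : L) (hx : d (d x) = 0) : OddHom.v₂ d (oddMk d x hx) = d x := by
  simp [OddHom.v₂, oddMk]

@[simp] theorem EvenHom.v_add (φ ψ : EvenHom d) :
    EvenHom.v d (φ + ψ) = EvenHom.v d φ + EvenHom.v d ψ := rfl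

@[simp] theorem EvenHom.v_smul (c : K) (φ : EvenHom d) :
    EvenHom.v d (c • φ) = c • EvenHom.v d φ := rfl

@[simp] theorem EvenHom.v_neg (φ : EvenHom d) : EvenHom.v d (-φ) = -EvenHom.v d φ := rfl

@[simp] theorem OddHom.v₁_add (φ ψ : OddHom d) :
    OddHom.v₁ d (φ + ψ) = OddHom.v₁ d φ + OddHom.v₁ d ψ := rfl

@[simp] theorem OddHom.v₁_smul (c : K) (φ : OddHom d) :
    OddHom.v₁ d (c • φ) = c • OddHom.v₁ d φ := rfl

@[simp] theorem OddHom.v₂_add (φ ψ : OddHom d) :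
    OddHom.v₂ d (φ + ψ) = OddHom.v₂ d φ + OddHom.v₂ d ψ := rfl

@[simp] theorem OddHom.v₂_smul (c : K) (φ : OddHom d) :
    OddHom.v₂ d (c • φ) = c • OddHom.v₂ d φ := rfl

/-- The bracket of `φ, ψ : J₁ → L`: the composite `J₁ = J₁ ⊗ J₁ → L ⊗ L → L`. -/
def br00 : EvenHom d →ₗ[K] EvenHom d →ₗ[K] EvenHom d :=
  LinearMap.mk₂ K
    (fun φ ψ => evenMk d ⁅EvenHom.v d φ, EvenHom.v d ψ⁆ (by simp [EvenHom.d_v]))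
    (fun _ _ _ => EvenHom.ext_v d (by simp)) (fun _ _ _ => EvenHom.ext_v d (by simp))
    (fun _ _ _ => EvenHom.ext_v d (by simp)) (fun _ _ _ => EvenHom.ext_v d (by simp))

/-- The bracket of `φ : J₁ → L` and `ψ : J₂ → L`: the composite `J₂ = J₁ ⊗ J₂ → L ⊗ L → L`,
i.e. the morphism `v ↦ [φ(1), ψ(v)]`. -/
def br01 : EvenHom d →ₗ[K] OddHom d →ₗ[K] OddHom d :=
  LinearMap.mk₂ K
    (fun φ ψ => oddMk d ⁅EvenHom.v d φ, OddHom.v₁ d ψ⁆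
      (by simp [EvenHom.d_v, OddHom.d_v₁, OddHom.d_v₂]))
    (fun _ _ _ => OddHom.ext_v d (by simp)) (fun _ _ _ => OddHom.ext_v d (by simp))
    (fun _ _ _ => OddHom.ext_v d (by simp)) (fun _ _ _ => OddHom.ext_v d (by simp))

theorem d_br11 (φ ψ : OddHom d) :
    d (-⁅OddHom.v₁ d φ, OddHom.v₂ d ψ⁆ + ⁅OddHom.v₂ d φ, OddHom.v₁ d ψ⁆) = 0 := by
  simp only [map_add, map_neg, LieDerivation.apply_lie_eq_add, OddHom.d_v₁, OddHom.d_v₂, lie_zero,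
    zero_lie, zero_add, add_zero, neg_add_cancel]

/-- The bracket of `φ, ψ : J₂ → L`: the composite `J₁ → J₂ ⊗ J₂ → L ⊗ L → L`, where
`J₁ → J₂ ⊗ J₂` is the inclusion `1 ↦ -v₁ ⊗ v₂ + v₂ ⊗ v₁` of the direct summand `J₁` of
`J₂ ⊗ J₂ = J₁ ⊕ J₃`. -/
def br11 : OddHom d →ₗ[K] OddHom d →ₗ[K] EvenHom d :=
  LinearMap.mk₂ K
    (fun φ ψ => evenMk d
      (-⁅OddHom.v₁ d φ, OddHom.v₂ d ψ⁆ + ⁅OddHom.v₂ d φ, OddHom.v₁ d ψ⁆) (d_br11 d φ ψ))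
    (fun _ _ _ => EvenHom.ext_v d (by
      simp only [evenMk_v, EvenHom.v_add, OddHom.v₁_add, OddHom.v₂_add, add_lie]; abel))
    (fun _ _ _ => EvenHom.ext_v d (by
      simp only [evenMk_v, EvenHom.v_smul, OddHom.v₁_smul, OddHom.v₂_smul, smul_lie, smul_add,
        smul_neg]))
    (fun _ _ _ => EvenHom.ext_v d (by
      simp only [evenMk_v, EvenHom.v_add, OddHom.v₁_add, OddHom.v₂_add, lie_add]; abel))
    (fun _ _ _ => EvenHom.ext_v d (by
      simp only [evenMk_v, EvenHom.v_smul, OddHom.v₁_smul, OddHom.v₂_smul, lie_smul, smul_add,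
        smul_neg]))

@[simp] theorem br00_v (φ ψ : EvenHom d) :
    EvenHom.v d (br00 d φ ψ) = ⁅EvenHom.v d φ, EvenHom.v d ψ⁆ := by simp [br00]

@[simp] theorem br01_v₁ (φ : EvenHom d) (ψ : OddHom d) :
    OddHom.v₁ d (br01 d φ ψ) = ⁅EvenHom.v d φ, OddHom.v₁ d ψ⁆ := by simp [br01]

@[simp] theorem br01_v₂ (φ : EvenHom d) (ψ : OddHom d) :
    OddHom.v₂ d (br01 d φ ψ) = ⁅EvenHom.v d φ, OddHom.v₂ d ψ⁆ := by
  simp [br01, EvenHom.d_v, OddHom.d_v₁]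

@[simp] theorem br11_v (φ ψ : OddHom d) :
    EvenHom.v d (br11 d φ ψ) =
      -⁅OddHom.v₁ d φ, OddHom.v₂ d ψ⁆ + ⁅OddHom.v₂ d φ, OddHom.v₁ d ψ⁆ := by
  rw [br11, LinearMap.mk₂_apply, evenMk_v]

theorem mem_negligible_even (φ : EvenHom d) :
    φ ∈ negligible (jordan K 1) (d : L →ₗ[K] L) ↔
      ∀ l : L →ₗ[K] K, (∀ z, l (d z) = 0) → l (EvenHom.v d φ) = 0 := by
  have tr1 : ∀ g : L →ₗ[K] (Fin 1 → K),
      LinearMap.trace K (Fin 1 → K) (g ∘ₗ φ.1) = g (EvenHom.v d φ) 0 := by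
    intro g
    rw [LinearMap.trace_eq_matrix_trace K (Pi.basisFun K (Fin 1))]
    simp [Matrix.trace, EvenHom.v]
  constructor
  · intro h l hl
    have := h (LinearMap.pi fun _ => l) (by
      change _ = _
      rw [jordan_one]
      ext z
      simp [hl])
    rw [tr1] at this
    simpa using this
  · intro h g hg
    rw [tr1]
    refine h ((LinearMap.proj 0) ∘ₗ g) (fun z => ?_)
    have := LinearMap.congr_fun hg z
    simp [jordan_one] at this
    simp [this]

theorem mem_negligible_odd [CharP K 3] (φ : OddHom d) :
    φ ∈ negligible (jordan K 2) (d : L →ₗ[K] L) ↔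
      ∀ l : L →ₗ[K] K, (∀ z, l (d (d z)) = 0) → l (OddHom.v₂ d φ) = 0 := by
  have h3 : (3 : K) = 0 := by exact_mod_cast CharP.cast_eq_zero K 3
  have tr2 : ∀ g : L →ₗ[K] (Fin 2 → K),
      LinearMap.trace K (Fin 2 → K) (g ∘ₗ φ.1) =
        g (OddHom.v₁ d φ) 0 + g (OddHom.v₂ d φ) 1 := by
    intro g
    rw [LinearMap.trace_eq_matrix_trace K (Pi.basisFun K (Fin 2))]
    simp [Matrix.trace, OddHom.v₁, OddHom.v₂, Fin.sum_univ_two]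
  constructor
  · intro h l hl
    have := h (LinearMap.pi ![l ∘ₗ (d : L →ₗ[K] L), l]) (by
      change _ = _
      apply LinearMap.ext
      intro z
      rw [LinearMap.comp_apply, LinearMap.comp_apply, jordan_two_apply]
      ext j
      fin_cases j <;> simp [hl])
    rw [tr2] at this
    simp [OddHom.d_v₁] at this
    linear_combination (-1 : K) * this + l (OddHom.v₂ d φ) * h3
  · intro h g hg
    rw [tr2]
    have hg' : ∀ z, g (d z) = ![0, g z 0] := fun z => by
      have := LinearMap.congr_fun hg z
      rw [LinearMap.comp_apply, LinearMap.comp_apply, jordan_two_apply] at this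
      exact this
    have h1 := h ((LinearMap.proj 1) ∘ₗ g) (fun z => by simp [hg'])
    have h2 : g (OddHom.v₂ d φ) 1 = g (OddHom.v₁ d φ) 0 := by
      rw [← OddHom.d_v₁, hg']
      simp
    simp only [LinearMap.comp_apply, LinearMap.proj_apply] at h1
    rw [← h2, h1, add_zero]

/-- The functional `z ↦ l [z, y]`. -/
def lieRight (l : L →ₗ[K] K) (y : L) : L →ₗ[K] K := -(l ∘ₗ (LieAlgebra.ad K L y : L →ₗ[K] L))

@[simp] theorem lieRight_apply (l : L →ₗ[K] K) (y z : L) : lieRight l y z = l ⁅z, y⁆ := by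
  rw [lieRight, ← lie_skew z y, map_neg]
  rfl

theorem neg00 (φ ψ : EvenHom d) (h : φ ∈ negligible (jordan K 1) (d : L →ₗ[K] L)) :
    br00 d φ ψ ∈ negligible (jordan K 1) (d : L →ₗ[K] L) := by
  rw [mem_negligible_even] at h ⊢
  intro l hl
  have := h (lieRight l (EvenHom.v d ψ)) (fun z => by
    have h1 := hl ⁅z, EvenHom.v d ψ⁆
    simpa [EvenHom.d_v] using h1)
  simpa using this

theorem br00_skew (φ ψ : EvenHom d) : br00 d φ ψ = -br00 d ψ φ :=
  EvenHom.ext_v d (by simp)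

theorem br11_symm (φ ψ : OddHom d) : br11 d φ ψ = br11 d ψ φ :=
  EvenHom.ext_v d (by
    rw [br11_v, br11_v, ← lie_skew (OddHom.v₂ d ψ) (OddHom.v₁ d φ),
      ← lie_skew (OddHom.v₁ d ψ) (OddHom.v₂ d φ)]
    abel)

theorem jacobi000_aux (a b c : EvenHom d) :
    br00 d a (br00 d b c) = br00 d (br00 d a b) c + br00 d b (br00 d a c) :=
  EvenHom.ext_v d (by simp)

theorem jacobi001_aux (a b : EvenHom d) (x : OddHom d) :
    br01 d a (br01 d b x) = br01 d (br00 d a b) x + br01 d b (br01 d a x) :=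
  OddHom.ext_v d (by simp)

theorem jacobi011_aux (a : EvenHom d) (x y : OddHom d) :
    br00 d a (br11 d x y) = br11 d (br01 d a x) y + br11 d x (br01 d a y) :=
  EvenHom.ext_v d (by
    simp only [br00_v, br11_v, br01_v₁, br01_v₂, EvenHom.v_add, lie_add, lie_neg]
    rw [leibniz_lie (EvenHom.v d a) (OddHom.v₁ d x), leibniz_lie (EvenHom.v d a) (OddHom.v₂ d x)]
    abel)

/-- The even part of the semisimplification: `Hom(J₁, L)` modulo negligible morphisms. -/
abbrev EvenPart : Type _ := ssHom (jordan K 1) (d : L →ₗ[K] L)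

/-- The odd part of the semisimplification: `Hom(J₂, L)` modulo negligible morphisms. -/
abbrev OddPart : Type _ := ssHom (jordan K 2) (d : L →ₗ[K] L)

/-- The class of a morphism `J₁ → L`. -/
def evenClass : EvenHom d →ₗ[K] EvenPart d := Submodule.mkQ _

/-- The class of a morphism `J₂ → L`. -/
def oddClass : OddHom d →ₗ[K] OddPart d := Submodule.mkQ _

theorem evenClass_surjective : Function.Surjective (evenClass d) := Submodule.mkQ_surjective _

theorem oddClass_surjective : Function.Surjective (oddClass d) := Submodule.mkQ_surjective _

theorem evenClass_eq_zero {φ : EvenHom d} :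
    evenClass d φ = 0 ↔ φ ∈ negligible (jordan K 1) (d : L →ₗ[K] L) :=
  Submodule.Quotient.mk_eq_zero _

theorem oddClass_eq_zero {φ : OddHom d} :
    oddClass d φ = 0 ↔ φ ∈ negligible (jordan K 2) (d : L →ₗ[K] L) :=
  Submodule.Quotient.mk_eq_zero _

section

variable [CharP K 3]

theorem neg01_left (φ : EvenHom d) (ψ : OddHom d)
    (h : φ ∈ negligible (jordan K 1) (d : L →ₗ[K] L)) :
    br01 d φ ψ ∈ negligible (jordan K 2) (d : L →ₗ[K] L) := by
  have h3 : (3 : K) = 0 := by exact_mod_cast CharP.cast_eq_zero K 3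
  rw [mem_negligible_even] at h
  rw [mem_negligible_odd]
  intro l hl
  have := h (lieRight (l ∘ₗ (d : L →ₗ[K] L)) (OddHom.v₁ d ψ) + lieRight l (OddHom.v₂ d ψ))
    (fun z => by
      have h1 := hl ⁅z, OddHom.v₁ d ψ⁆
      simp [OddHom.d_v₁, OddHom.d_v₂] at h1 ⊢
      linear_combination h1)
  simp [OddHom.d_v₁, EvenHom.d_v] at this
  rw [br01_v₂]
  linear_combination (-1 : K) * this + l ⁅EvenHom.v d φ, OddHom.v₂ d ψ⁆ * h3

theorem neg01_right (φ : EvenHom d) (ψ : OddHom d)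
    (h : ψ ∈ negligible (jordan K 2) (d : L →ₗ[K] L)) :
    br01 d φ ψ ∈ negligible (jordan K 2) (d : L →ₗ[K] L) := by
  rw [mem_negligible_odd] at h ⊢
  intro l hl
  have := h (l ∘ₗ (LieAlgebra.ad K L (EvenHom.v d φ) : L →ₗ[K] L)) (fun z => by
    have h1 := hl ⁅EvenHom.v d φ, z⁆
    simpa [EvenHom.d_v] using h1)
  simpa using this

theorem neg11 (φ ψ : OddHom d) (h : φ ∈ negligible (jordan K 2) (d : L →ₗ[K] L)) :
    br11 d φ ψ ∈ negligible (jordan K 1) (d : L →ₗ[K] L) := by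
  have h3 : (3 : K) = 0 := by exact_mod_cast CharP.cast_eq_zero K 3
  rw [mem_negligible_odd] at h
  rw [mem_negligible_even]
  intro l hl
  have h0 := h (lieRight l (OddHom.v₁ d ψ)) (fun z => by
    have h1 := hl (d ⁅z, OddHom.v₁ d ψ⁆)
    have h2 := hl ⁅z, OddHom.v₂ d ψ⁆
    simp only [LieDerivation.apply_lie_eq_add, map_add, OddHom.d_v₁, OddHom.d_v₂, lie_zero,
      zero_add, lieRight_apply] at h1 h2 ⊢
    rw [h2, zero_add, zero_add] at h1
    exact h1)
  have h1 := hl ⁅OddHom.v₁ d φ, OddHom.v₁ d ψ⁆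
  simp only [LieDerivation.apply_lie_eq_add, map_add, OddHom.d_v₁, lieRight_apply] at h0 h1
  rw [br11_v, map_add, map_neg]
  linear_combination 2 * h0 - h1

theorem jacobi111_aux (φ ψ χ : OddHom d) :
    br01 d (br11 d φ ψ) χ + br01 d (br11 d ψ χ) φ + br01 d (br11 d χ φ) ψ ∈
      negligible (jordan K 2) (d : L →ₗ[K] L) := by
  have h3 : (3 : K) = 0 := by exact_mod_cast CharP.cast_eq_zero K 3
  rw [mem_negligible_odd]
  intro l hl
  have key : ∀ p q r : L, l ⁅⁅p, q⁆, r⁆ + l ⁅⁅q, r⁆, p⁆ + l ⁅⁅r, p⁆, q⁆ = 0 := fun p q r => by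
    rw [← map_add, ← map_add, ← lie_skew ⁅p, q⁆ r, ← lie_skew ⁅q, r⁆ p, ← lie_skew ⁅r, p⁆ q,
      ← neg_add, ← neg_add, map_neg, lie_jacobi r p q, map_zero, neg_zero]
  have skew : ∀ p q r : L, l ⁅⁅p, q⁆, r⁆ = -l ⁅⁅q, p⁆, r⁆ := fun p q r => by
    rw [← lie_skew p q, neg_lie, map_neg]
  have ex := OddHom.d_v₁ d φ
  have ey := OddHom.d_v₁ d ψ
  have ez := OddHom.d_v₁ d χ
  have ex' := OddHom.d_v₂ d φ
  have ey' := OddHom.d_v₂ d ψ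
  have ez' := OddHom.d_v₂ d χ
  rw [OddHom.v₂_add, OddHom.v₂_add, br01_v₂, br01_v₂, br01_v₂, br11_v, br11_v, br11_v]
  generalize OddHom.v₁ d φ = x at *
  generalize OddHom.v₁ d ψ = y at *
  generalize OddHom.v₁ d χ = z at *
  generalize OddHom.v₂ d φ = a at *
  generalize OddHom.v₂ d ψ = b at *
  generalize OddHom.v₂ d χ = c at *
  have hT := hl ⁅⁅x, y⁆, z⁆
  have hU := hl ⁅⁅x, z⁆, y⁆
  simp only [LieDerivation.apply_lie_eq_add, map_add, add_lie, ex, ey, ez, ex', ey', ez',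
    lie_zero, zero_lie, zero_add, add_zero, neg_lie, map_neg] at hT hU ⊢
  have k1 := key a b z
  have k2 := key a y c
  have k3 := key x b c
  rw [skew a c y, skew a z b, skew x c b] at hU
  linear_combination hT + hU + k1 - k2
    + (l ⁅⁅c, a⁆, y⁆ + l ⁅⁅c, x⁆, b⁆ - l ⁅⁅a, b⁆, z⁆ - l ⁅⁅x, b⁆, c⁆) * h3

/-- The bracket of even elements of the semisimplification, induced by `br00`. -/
def ssBr00 : EvenPart d →ₗ[K] EvenPart d →ₗ[K] EvenPart d :=
  quotLift₂ _ _ ((br00 d).compr₂ (evenClass d))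
    (fun φ h ψ => (evenClass_eq_zero d).2 (neg00 d φ ψ h))
    (fun φ ψ h => (evenClass_eq_zero d).2 (by
      rw [br00_skew]
      exact Submodule.neg_mem _ (neg00 d ψ φ h)))

/-- The bracket of an even and an odd element of the semisimplification, induced by `br01`. -/
def ssBr01 : EvenPart d →ₗ[K] OddPart d →ₗ[K] OddPart d :=
  quotLift₂ _ _ ((br01 d).compr₂ (oddClass d))
    (fun φ h ψ => (oddClass_eq_zero d).2 (neg01_left d φ ψ h))
    (fun φ ψ h => (oddClass_eq_zero d).2 (neg01_right d φ ψ h))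

/-- The bracket of odd elements of the semisimplification, induced by `br11`. -/
def ssBr11 : OddPart d →ₗ[K] OddPart d →ₗ[K] EvenPart d :=
  quotLift₂ _ _ ((br11 d).compr₂ (evenClass d))
    (fun φ h ψ => (evenClass_eq_zero d).2 (neg11 d φ ψ h))
    (fun φ ψ h => (evenClass_eq_zero d).2 (by
      rw [br11_symm]
      exact neg11 d ψ φ h))

theorem ssBr00_class (φ ψ : EvenHom d) :
    ssBr00 d (evenClass d φ) (evenClass d ψ) = evenClass d (br00 d φ ψ) := rfl

theorem ssBr01_class (φ : EvenHom d) (ψ : OddHom d) :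
    ssBr01 d (evenClass d φ) (oddClass d ψ) = oddClass d (br01 d φ ψ) := rfl

theorem ssBr11_class (φ ψ : OddHom d) :
    ssBr11 d (oddClass d φ) (oddClass d ψ) = evenClass d (br11 d φ ψ) := rfl

/-- The semisimplification of a Lie algebra `(L, d)` in `Rep α₃`. In the semisimplification
`Ver₃` of `Rep α₃` (morphisms modulo negligible morphisms) the simple objects are the images
of the unit object `J₁` and of `J₂`, and `X ↦ Hom(J₁, X) ⊕ Hom(J₂, X)` identifies
`Ver₃` with the category of super vector spaces. The even and odd parts are therefore the
morphisms from `J₁` and `J₂` to `L` modulo negligible morphisms, and the bracket is the one induced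
by the bracket of `L`. -/
def semisimplification (_ : IsInRepAlpha3 d) : LieSuperalgebra K where
  even := EvenPart d
  odd := OddPart d
  b00 := ssBr00 d
  b01 := ssBr01 d
  b11 := ssBr11 d
  skew00 a b := by
    obtain ⟨a, rfl⟩ := evenClass_surjective d a
    obtain ⟨b, rfl⟩ := evenClass_surjective d b
    rw [ssBr00_class, ssBr00_class, br00_skew, map_neg]
  symm11 x y := by
    obtain ⟨x, rfl⟩ := oddClass_surjective d x
    obtain ⟨y, rfl⟩ := oddClass_surjective d y
    rw [ssBr11_class, ssBr11_class, br11_symm]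
  jacobi000 a b c := by
    obtain ⟨a, rfl⟩ := evenClass_surjective d a
    obtain ⟨b, rfl⟩ := evenClass_surjective d b
    obtain ⟨c, rfl⟩ := evenClass_surjective d c
    simp only [ssBr00_class, jacobi000_aux d a b c, map_add]
  jacobi001 a b x := by
    obtain ⟨a, rfl⟩ := evenClass_surjective d a
    obtain ⟨b, rfl⟩ := evenClass_surjective d b
    obtain ⟨x, rfl⟩ := oddClass_surjective d x
    simp only [ssBr00_class, ssBr01_class, jacobi001_aux d a b x, map_add]
  jacobi011 a x y := by
    obtain ⟨a, rfl⟩ := evenClass_surjective d a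
    obtain ⟨x, rfl⟩ := oddClass_surjective d x
    obtain ⟨y, rfl⟩ := oddClass_surjective d y
    simp only [ssBr00_class, ssBr01_class, ssBr11_class, jacobi011_aux d a x y, map_add]
  jacobi111 x y z := by
    obtain ⟨x, rfl⟩ := oddClass_surjective d x
    obtain ⟨y, rfl⟩ := oddClass_surjective d y
    obtain ⟨z, rfl⟩ := oddClass_surjective d z
    simp only [ssBr01_class, ssBr11_class, ← map_add]
    exact (oddClass_eq_zero d).2 (jacobi111_aux d x y z)

end

end Semisimplification

end ExcLie

end

/-!
The proof separates the Lie algebra `g(A)` from the semisimplification. For the latter,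
functoriality suffices: an automorphism of `g(A)` that maps `e_I` to `e_J` intertwines `ad e_I`
and `ad e_J`, hence identifies the morphisms from `J₁` and `J₂`, the negligible ones among them,
and the brackets (`nonempty_semisimplification_iso`). So everything follows from `(ad e_I)³ = 0`,
finite-dimensionality of `g(A)`, and the conjugacy of `e_I` and `e_J` under the adjoint group.

Conjugacy is a computation for a single legal swap. If `i` and `j` are joined by a single edge,
then `exp (ad eᵢ) exp (-ad fᵢ) exp (-ad fⱼ) exp (ad eⱼ)` maps `eᵢ` to `eⱼ` by the Serre relations,
and it fixes every `eₖ` with `k` adjacent neither to `i` nor to `j`; legality of the swap says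
that these are all the other black nodes. As the black nodes are pairwise non-adjacent, the `ad
eᵢ`, `i ∈ I`, commute, and `(ad e_I)³ = ∑ (ad eᵢ)³ = 0` in characteristic three. The truncated
exponentials are automorphisms if, besides `(ad x)³ = 0`, two identities hold which in
characteristic zero would follow from it (`IsExpNilpotent`).

It remains to show that `g(A)` is finite-dimensional and that the `eᵢ` and `fᵢ` satisfy these
identities; no root system or Chevalley basis is needed. By the maximality of the ideal `r`, an
element of positive degree of `g(A)` which is killed by all `ad fᵢ` vanishes (`nondegenerate_e`).
To prove this one has to see that the ideal generated by such an element meets the Cartan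
subalgebra of `g̃(A)` trivially. This is detected by the Harish-Chandra projection, the highest
weight coefficient of the action on Verma modules, where the weight is arbitrary because the Verma
modules are constructed over `g̃(A)`. In the simply laced types, let `q β = ½ βᵀ A β`. Induction
on the height shows that every degree `β` of `g(A)` satisfies `q β ≤ 1`
(`wordSpan_eq_bot_of_two_le`): there are finitely many of them, each of finite multiplicity, and
`q (β + αᵢ) + q (β - αᵢ) = 2 q β + 2` leaves no room for `(ad eᵢ)²` outside degree `-αᵢ`, where it
maps `fᵢ` to `-2 eᵢ`.

The diagram of type `F₄` is a folding of that of type `E₆`. The sums of Chevalley generators over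
the orbits satisfy the relations of `g̃(F₄)`, and the homogeneous elements of the kernel of the
resulting map `g̃(F₄) → g(E₆)` vanish in `g(F₄)`, again by the maximality of `r`. Hence finiteness
and the identities for the exponentials descend from `E₆` to `F₄` (`isFiniteType_F₄`).
-/

namespace ExcLie

/-! ### Exponentials of elements with `(ad x)³ = 0` -/

section QuadExp

variable {K L : Type*} [Field K] [LieRing L] [LieAlgebra K L]

theorem two_ne_zero_of_charP_three (K : Type*) [Field K] [CharP K 3] : (2 : K) ≠ 0 := by
  intro h
  have h3 : (3 : K) = 0 := by exact_mod_cast CharP.cast_eq_zero K 3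
  exact one_ne_zero (α := K) (by linear_combination h3 - h)

/-- The truncated exponential `1 + t ad x + (t² / 2) (ad x)²`. -/
def quadExp (x : L) (t : K) : L →ₗ[K] L :=
  LinearMap.id + t • (LieAlgebra.ad K L x : L →ₗ[K] L) +
    (t ^ 2 / 2) • ((LieAlgebra.ad K L x : L →ₗ[K] L) ∘ₗ (LieAlgebra.ad K L x : L →ₗ[K] L))

theorem quadExp_apply (x : L) (t : K) (y : L) :
    quadExp x t y = y + t • ⁅x, y⁆ + (t ^ 2 / 2) • ⁅x, ⁅x, y⁆⁆ := rfl

/-- The identities for `D = ad x` which make `1 + t D + (t² / 2) D²` a one-parameter group of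
automorphisms. In characteristic three, `mixed` and `top` do not follow from `D³ = 0`:
they are the Leibniz rules for the divided powers `D³ / 3!` and `D⁴ / 4!`, with these put to
zero. -/
structure IsExpNilpotent (x : L) : Prop where
  cube : ∀ y : L, ⁅x, ⁅x, ⁅x, y⁆⁆⁆ = 0
  mixed : ∀ y z : L, ⁅⁅x, y⁆, ⁅x, ⁅x, z⁆⁆⁆ + ⁅⁅x, ⁅x, y⁆⁆, ⁅x, z⁆⁆ = 0
  top : ∀ y z : L, ⁅⁅x, ⁅x, y⁆⁆, ⁅x, ⁅x, z⁆⁆⁆ = 0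

theorem lie_lie_bracket (x y z : L) :
    ⁅x, ⁅x, ⁅y, z⁆⁆⁆ = ⁅⁅x, ⁅x, y⁆⁆, z⁆ + (2 : K) • ⁅⁅x, y⁆, ⁅x, z⁆⁆ + ⁅y, ⁅x, ⁅x, z⁆⁆⁆ := by
  rw [leibniz_lie x y z, lie_add, leibniz_lie x ⁅x, y⁆ z, leibniz_lie x y ⁅x, z⁆, two_smul]
  abel

theorem quadExp_lie_sub (h2 : (2 : K) ≠ 0) (x : L) (t : K) (y z : L) :
    ⁅quadExp x t y, quadExp x t z⁆ - quadExp x t ⁅y, z⁆ =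
      (t ^ 3 / 2) • (⁅⁅x, y⁆, ⁅x, ⁅x, z⁆⁆⁆ + ⁅⁅x, ⁅x, y⁆⁆, ⁅x, z⁆⁆) +
        (t ^ 4 / 4) • ⁅⁅x, ⁅x, y⁆⁆, ⁅x, ⁅x, z⁆⁆⁆ := by
  have h4 : (4 : K) ≠ 0 := by
    have : (4 : K) = 2 * 2 := by norm_num
    rw [this]
    exact mul_ne_zero h2 h2
  rw [quadExp_apply x t ⁅y, z⁆, lie_lie_bracket (K := K) x y z, leibniz_lie x y z]
  simp only [quadExp_apply, add_lie, lie_add, smul_lie, lie_smul]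
  match_scalars <;> field_simp <;> ring

theorem IsExpNilpotent.quadExp_lie (h2 : (2 : K) ≠ 0) {x : L} (hx : IsExpNilpotent x) (t : K)
    (y z : L) : quadExp x t ⁅y, z⁆ = ⁅quadExp x t y, quadExp x t z⁆ := by
  have := quadExp_lie_sub h2 x t y z
  rw [hx.mixed, hx.top, smul_zero, smul_zero, add_zero, sub_eq_zero] at this
  exact this.symm

/-- If `(ad x)³ = 0` and `1 ± ad x + (ad x)² / 2` preserve the bracket, then the identities of
`IsExpNilpotent` hold, because the coefficients of `t³` and `t⁴` can be separated by
the two values `t = ± 1`. -/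
theorem isExpNilpotent_of_quadExp_lie (h2 : (2 : K) ≠ 0) {x : L}
    (h : ∀ y : L, ⁅x, ⁅x, ⁅x, y⁆⁆⁆ = 0)
    (hx : ∀ (t : K) (y z : L), quadExp x t ⁅y, z⁆ = ⁅quadExp x t y, quadExp x t z⁆) :
    IsExpNilpotent x := by
  have h4 : (4 : K) ≠ 0 := by
    have : (4 : K) = 2 * 2 := by norm_num
    rw [this]
    exact mul_ne_zero h2 h2
  have key : ∀ y z : L, ⁅⁅x, y⁆, ⁅x, ⁅x, z⁆⁆⁆ + ⁅⁅x, ⁅x, y⁆⁆, ⁅x, z⁆⁆ = 0 ∧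
      ⁅⁅x, ⁅x, y⁆⁆, ⁅x, ⁅x, z⁆⁆⁆ = 0 := by
    intro y z
    have h1 := quadExp_lie_sub h2 x (1 : K) y z
    have h1' := quadExp_lie_sub h2 x (-1 : K) y z
    rw [hx, sub_self] at h1 h1'
    generalize ⁅⁅x, y⁆, ⁅x, ⁅x, z⁆⁆⁆ + ⁅⁅x, ⁅x, y⁆⁆, ⁅x, z⁆⁆ = a at h1 h1' ⊢
    generalize ⁅⁅x, ⁅x, y⁆⁆, ⁅x, ⁅x, z⁆⁆⁆ = b at h1 h1' ⊢
    constructor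
    · calc a = ((1 : K) ^ 3 / 2) • a + ((1 : K) ^ 4 / 4) • b -
          (((-1 : K) ^ 3 / 2) • a + ((-1 : K) ^ 4 / 4) • b) := by
            match_scalars <;> field_simp <;> ring
        _ = 0 := by rw [← h1, ← h1', sub_zero]
    · calc b = (2 : K) • (((1 : K) ^ 3 / 2) • a + ((1 : K) ^ 4 / 4) • b) +
          (2 : K) • (((-1 : K) ^ 3 / 2) • a + ((-1 : K) ^ 4 / 4) • b) := by
            match_scalars <;> field_simp <;> ring
        _ = 0 := by rw [← h1, ← h1', smul_zero, add_zero]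
  exact ⟨h, fun y z => (key y z).1, fun y z => (key y z).2⟩

/-- The exponential of an element satisfying `IsExpNilpotent`, as an automorphism. -/
def expEquiv (h2 : (2 : K) ≠ 0) {x : L} (hx : IsExpNilpotent x) (t : K) : L ≃ₗ⁅K⁆ L where
  toFun := quadExp x t
  invFun := quadExp x (-t)
  map_add' := map_add _
  map_smul' := map_smul _
  map_lie' := hx.quadExp_lie h2 t _ _
  left_inv y := by
    simp only [quadExp_apply, lie_add, lie_smul, hx.cube, smul_zero, lie_zero]
    match_scalars <;> field_simp <;> ring
  right_inv y := by
    simp only [quadExp_apply, lie_add, lie_smul, hx.cube, smul_zero, lie_zero]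
    match_scalars <;> field_simp <;> ring

theorem expEquiv_apply (h2 : (2 : K) ≠ 0) {x : L} (hx : IsExpNilpotent x) (t : K) (y : L) :
    expEquiv h2 hx t y = y + t • ⁅x, y⁆ + (t ^ 2 / 2) • ⁅x, ⁅x, y⁆⁆ := rfl

theorem expEquiv_apply_of_lie_lie_eq_zero (h2 : (2 : K) ≠ 0) {x : L} (hx : IsExpNilpotent x) (t : K)
    {y : L} (hy : ⁅x, ⁅x, y⁆⁆ = 0) : expEquiv h2 hx t y = y + t • ⁅x, y⁆ := by
  rw [expEquiv_apply, hy, smul_zero, add_zero]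

theorem expEquiv_apply_of_lie_eq_zero (h2 : (2 : K) ≠ 0) {x : L} (hx : IsExpNilpotent x) (t : K)
    {y : L} (hy : ⁅x, y⁆ = 0) : expEquiv h2 hx t y = y := by
  rw [expEquiv_apply, hy, lie_zero, smul_zero, smul_zero, add_zero, add_zero]

/-- If `a` and `b` commute and `(ad a)² ad b = ad a (ad b)² = 0`, then
`exp (t ad (a + b)) = exp (t ad a) exp (t ad b)` holds for the truncated exponentials, so that the
left-hand side is an automorphism. -/
theorem IsExpNilpotent.add [CharP K 3] {a b : L} (ha : IsExpNilpotent a)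
    (hb : IsExpNilpotent b) (hab : ⁅a, b⁆ = 0) (haab : ∀ y : L, ⁅a, ⁅a, ⁅b, y⁆⁆⁆ = 0)
    (habb : ∀ y : L, ⁅a, ⁅b, ⁅b, y⁆⁆⁆ = 0) : IsExpNilpotent (a + b) := by
  have h2 := two_ne_zero_of_charP_three K
  have hcomm : ∀ y : L, ⁅b, ⁅a, y⁆⁆ = ⁅a, ⁅b, y⁆⁆ := fun y => by
    rw [leibniz_lie a b y, hab, zero_lie, zero_add]
  refine isExpNilpotent_of_quadExp_lie (K := K) h2 (fun y => ?_) fun t y z => ?_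
  · simp only [add_lie, lie_add, hcomm, ha.cube, hb.cube, haab, habb, add_zero]
  · have hE : ∀ y, quadExp (a + b) t y = quadExp a t (quadExp b t y) := fun y => by
      simp only [quadExp_apply, add_lie, lie_add, lie_smul, hcomm, haab, habb, smul_zero,
        lie_zero]
      match_scalars <;> field_simp <;> norm_num
    rw [hE, hE, hE, hb.quadExp_lie h2, ha.quadExp_lie h2]

end QuadExp

/-! ### Transport of the semisimplification along an isomorphism -/

section Transport

variable {K L M : Type*} [Field K] [LieRing L] [LieAlgebra K L] [LieRing M] [LieAlgebra K M]

section Linear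

variable {V W W' : Type*} [AddCommGroup V] [Module K V] [AddCommGroup W] [Module K W]
  [AddCommGroup W'] [Module K W']

/-- Composition with an isomorphism `(W, t) ≃ (W', t')` identifies the morphisms
`(V, s) → (W, t)` and `(V, s) → (W', t')`. -/
def repHomCongr (s : Module.End K V) {t : Module.End K W} {t' : Module.End K W'} (φ : W ≃ₗ[K] W')
    (h : ∀ w, φ (t w) = t' (φ w)) : repHom s t ≃ₗ[K] repHom s t' where
  toFun α := ⟨φ.toLinearMap ∘ₗ α.1, by
    change _ = _
    ext v
    have := LinearMap.congr_fun α.2 v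
    simp only [LinearMap.comp_apply, LinearEquiv.coe_coe] at this ⊢
    rw [this, h]⟩
  invFun α := ⟨φ.symm.toLinearMap ∘ₗ α.1, by
    change _ = _
    ext v
    have := LinearMap.congr_fun α.2 v
    simp only [LinearMap.comp_apply, LinearEquiv.coe_coe] at this ⊢
    rw [this, LinearEquiv.symm_apply_eq, h, LinearEquiv.apply_symm_apply]⟩
  map_add' α β := Subtype.ext (LinearMap.comp_add _ _ _)
  map_smul' c α := Subtype.ext (LinearMap.comp_smul _ _ _)
  left_inv α := by
    apply Subtype.ext
    ext v
    simp
  right_inv α := by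
    apply Subtype.ext
    ext v
    simp

theorem repHomCongr_mem_negligible (s : Module.End K V) {t : Module.End K W}
    {t' : Module.End K W'} (φ : W ≃ₗ[K] W') (h : ∀ w, φ (t w) = t' (φ w)) {α : repHom s t}
    (hα : α ∈ negligible s t) : repHomCongr s φ h α ∈ negligible s t' := by
  intro ψ hψ
  have := hα (ψ ∘ₗ φ.toLinearMap) (by
    change _ = _
    ext w
    have := LinearMap.congr_fun hψ (φ w)
    simp only [LinearMap.comp_apply, LinearEquiv.coe_coe] at this ⊢
    rw [h, this])
  exact this

theorem negligible_map_repHomCongr (s : Module.End K V) {t : Module.End K W}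
    {t' : Module.End K W'} (φ : W ≃ₗ[K] W') (h : ∀ w, φ (t w) = t' (φ w)) :
    (negligible s t).map (repHomCongr s φ h).toLinearMap = negligible s t' := by
  have h' : ∀ w, φ.symm (t' w) = t (φ.symm w) := fun w => by
    rw [LinearEquiv.symm_apply_eq, h, LinearEquiv.apply_symm_apply]
  apply le_antisymm
  · rintro _ ⟨α, hα, rfl⟩
    exact repHomCongr_mem_negligible s φ h hα
  · intro β hβ
    exact ⟨repHomCongr s φ.symm h' β, repHomCongr_mem_negligible s φ.symm h' hβ,
      (repHomCongr s φ h).apply_symm_apply β⟩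

/-- The isomorphism of morphism spaces in the semisimplification induced by an isomorphism
`(W, t) ≃ (W', t')`. -/
def ssHomCongr (s : Module.End K V) {t : Module.End K W} {t' : Module.End K W'} (φ : W ≃ₗ[K] W')
    (h : ∀ w, φ (t w) = t' (φ w)) : ssHom s t ≃ₗ[K] ssHom s t' :=
  Submodule.Quotient.equiv _ _ (repHomCongr s φ h) (negligible_map_repHomCongr s φ h)

end Linear

/-- An isomorphism of Lie algebras in `Rep α₃` induces an isomorphism of the
semisimplifications. -/
theorem nonempty_semisimplification_iso [CharP K 3] {d : LieDerivation K L L}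
    {d' : LieDerivation K M M} (hd : IsInRepAlpha3 d) (hd' : IsInRepAlpha3 d') (φ : L ≃ₗ⁅K⁆ M)
    (h : ∀ x, φ (d x) = d' (φ x)) :
    Nonempty (LieSuperalgebra.Iso (semisimplification d hd) (semisimplification d' hd')) :=
  ⟨{ evenEquiv := ssHomCongr (jordan K 1) φ.toLinearEquiv h
     oddEquiv := ssHomCongr (jordan K 2) φ.toLinearEquiv h
     map_b00 := fun a b => by
       obtain ⟨a, rfl⟩ := evenClass_surjective d a
       obtain ⟨b, rfl⟩ := evenClass_surjective d b
       refine congrArg (evenClass d') (EvenHom.ext_v d' ?_)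
       exact (congrArg φ (br00_v d a b)).trans ((LieEquiv.map_lie φ _ _).trans
         (br00_v d' (repHomCongr (jordan K 1) φ.toLinearEquiv h a)
           (repHomCongr (jordan K 1) φ.toLinearEquiv h b)).symm)
     map_b01 := fun a x => by
       obtain ⟨a, rfl⟩ := evenClass_surjective d a
       obtain ⟨x, rfl⟩ := oddClass_surjective d x
       refine congrArg (oddClass d') (OddHom.ext_v d' ?_)
       exact (congrArg φ (br01_v₁ d a x)).trans ((LieEquiv.map_lie φ _ _).trans
         (br01_v₁ d' (repHomCongr (jordan K 1) φ.toLinearEquiv h a)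
           (repHomCongr (jordan K 2) φ.toLinearEquiv h x)).symm)
     map_b11 := fun x y => by
       obtain ⟨x, rfl⟩ := oddClass_surjective d x
       obtain ⟨y, rfl⟩ := oddClass_surjective d y
       refine congrArg (evenClass d') (EvenHom.ext_v d' ?_)
       refine (congrArg φ (br11_v d x y)).trans (Eq.trans ?_ (br11_v d' _ _).symm)
       rw [map_add, map_neg, LieEquiv.map_lie, LieEquiv.map_lie]
       rfl }⟩

end Transport

/-! ### Chevalley relations and iterated brackets -/

section Words

open Matrix

/-- The relations of `g̃(A)` for elements `eᵢ, fᵢ, hᵢ` of a Lie algebra. -/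
structure ChevalleyRel {n : ℕ} {L : Type*} [LieRing L] (A : Matrix (Fin n) (Fin n) ℤ)
    (e f h : Fin n → L) : Prop where
  hh : ∀ i j, ⁅h i, h j⁆ = 0
  ef : ∀ i j, ⁅e i, f j⁆ = if i = j then h i else 0
  he : ∀ i j, ⁅h i, e j⁆ = A i j • e j
  hf : ∀ i j, ⁅h i, f j⁆ = -(A i j • f j)

variable {n : ℕ} {K L : Type*} [Field K] [LieRing L] [LieAlgebra K L]
  {A : Matrix (Fin n) (Fin n) ℤ} {e f h : Fin n → L}

/-- The Chevalley involution: the relations are stable under `(e, f, h) ↦ (f, e, -h)`. -/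
theorem ChevalleyRel.swap (H : ChevalleyRel A e f h) : ChevalleyRel A f e (-h) where
  hh i j := by simp [H.hh]
  ef i j := by
    rw [← lie_skew, H.ef]
    by_cases hij : i = j
    · subst hij; simp
    · simp [hij, Ne.symm hij]
  he i j := by simp [H.hf]
  hf i j := by simp [H.he]

/-- `IsWord x β y`: the element `y` is an iterated bracket `[xᵢ, [xⱼ, … , xₖ]]` and
`β = αᵢ + αⱼ + ⋯ + αₖ`. -/
inductive IsWord (x : Fin n → L) : (Fin n → ℤ) → L → Prop
  | gen (i : Fin n) : IsWord x (Pi.single i 1) (x i)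
  | lie (i : Fin n) {β : Fin n → ℤ} {y : L} :
      IsWord x β y → IsWord x (β + Pi.single i 1) ⁅x i, y⁆

theorem IsWord.cases_eq {x : Fin n → L} {β : Fin n → ℤ} {y : L} (hy : IsWord x β y) :
    (∃ i, β = Pi.single i 1 ∧ y = x i) ∨
      ∃ i γ z, IsWord x γ z ∧ β = γ + Pi.single i 1 ∧ y = ⁅x i, z⁆ := by
  cases hy with
  | gen i => exact Or.inl ⟨i, rfl, rfl⟩
  | lie i hz => exact Or.inr ⟨i, _, _, hz, rfl, rfl⟩

theorem sum_add_single (β : Fin n → ℤ) (i : Fin n) :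
    ∑ j, (β + Pi.single i 1 : Fin n → ℤ) j = (∑ j, β j) + 1 := by
  simp [Finset.sum_add_distrib]

theorem sum_sub_single (β : Fin n → ℤ) (i : Fin n) :
    ∑ j, (β - Pi.single i 1 : Fin n → ℤ) j = (∑ j, β j) - 1 := by
  simp [Finset.sum_sub_distrib]

theorem IsWord.one_le_sum {x : Fin n → L} {β : Fin n → ℤ} {y : L} (hy : IsWord x β y) :
    1 ≤ ∑ j, β j := by
  induction hy with
  | gen i => simp
  | lie i _ ih => rw [sum_add_single]; lia

theorem IsWord.ne_zero {x : Fin n → L} {β : Fin n → ℤ} {y : L} (hy : IsWord x β y) : β ≠ 0 := by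
  rintro rfl
  have := hy.one_le_sum
  simp at this

theorem IsWord.eq_gen {x : Fin n → L} {i : Fin n} {y : L} (hy : IsWord x (Pi.single i 1) y) :
    y = x i := by
  rcases hy.cases_eq with ⟨j, hj, rfl⟩ | ⟨j, γ, z, hz, hγ, rfl⟩
  · have := congrFun hj j
    by_cases hij : i = j
    · rw [hij]
    · simp [hij] at this
  · have h1 := hz.one_le_sum
    have h2 := sum_add_single γ j
    rw [← hγ] at h2
    simp at h2
    lia

/-- Only finitely many iterated brackets have a given degree. -/
theorem finite_setOf_isWord (x : Fin n → L) (β : Fin n → ℤ) : {y | IsWord x β y}.Finite := by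
  have key : ∀ (m : ℕ) (β : Fin n → ℤ), ∑ j, β j ≤ m → {y | IsWord x β y}.Finite := by
    intro m
    induction m with
    | zero =>
      intro β hβ
      convert Set.finite_empty (α := L)
      ext y
      simp only [Set.mem_ofPred_eq, Set.mem_empty_iff_false, iff_false]
      intro hy
      have := hy.one_le_sum
      push_cast at hβ
      lia
    | succ m ih =>
      intro β hβ
      refine Set.Finite.subset ((Set.finite_range x).union (Set.finite_iUnion fun i =>
        (ih (β - Pi.single i 1) ?_).image fun y => ⁅x i, y⁆)) ?_
      · rw [sum_sub_single]
        push_cast at hβ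
        lia
      · intro y hy
        rcases IsWord.cases_eq hy with ⟨i, -, rfl⟩ | ⟨i, γ, z, hz, rfl, rfl⟩
        · exact Or.inl ⟨i, rfl⟩
        · refine Or.inr (Set.mem_iUnion.2 ⟨i, z, ?_, rfl⟩)
          simpa using hz
  exact key (∑ j, β j).toNat β (Int.self_le_toNat _)

theorem mulVec_single_one_apply (A : Matrix (Fin n) (Fin n) ℤ) (i j : Fin n) :
    (A *ᵥ Pi.single j 1) i = A i j := by
  simp

theorem IsWord.lie_h (H : ChevalleyRel A e f h) {β : Fin n → ℤ} {y : L} (hy : IsWord e β y)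
    (i : Fin n) : ⁅h i, y⁆ = (A *ᵥ β) i • y := by
  induction hy with
  | gen j => rw [H.he, mulVec_single_one_apply]
  | lie j _ ih =>
    rw [leibniz_lie, ih, H.he, Matrix.mulVec_add, Pi.add_apply, mulVec_single_one_apply, add_smul,
      lie_zsmul, zsmul_lie, add_comm]

variable (K) in
/-- The span of the iterated brackets of the `xᵢ` of degree `β`. -/
def wordSpan (x : Fin n → L) (β : Fin n → ℤ) : Submodule K L :=
  Submodule.span K {y | IsWord x β y}

theorem IsWord.mem {x : Fin n → L} {β : Fin n → ℤ} {y : L} (hy : IsWord x β y) :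
    y ∈ wordSpan K x β :=
  Submodule.subset_span hy

theorem wordSpan_le {x : Fin n → L} {β : Fin n → ℤ} {S : Submodule K L}
    (hS : ∀ y, IsWord x β y → y ∈ S) : wordSpan K x β ≤ S :=
  Submodule.span_le.2 hS

theorem lie_mem_of_forall_isWord {x : Fin n → L} {β : Fin n → ℤ} {S : Submodule K L} (u : L)
    (hS : ∀ y, IsWord x β y → ⁅u, y⁆ ∈ S) {y : L} (hy : y ∈ wordSpan K x β) : ⁅u, y⁆ ∈ S :=
  wordSpan_le (S := S.comap (LieAlgebra.ad K L u : L →ₗ[K] L)) hS hy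

theorem lie_mem_wordSpan {x : Fin n → L} {β : Fin n → ℤ} {y : L} (hy : y ∈ wordSpan K x β)
    (i : Fin n) : ⁅x i, y⁆ ∈ wordSpan K x (β + Pi.single i 1) :=
  lie_mem_of_forall_isWord _ (fun _ hz => (hz.lie i).mem) hy

theorem wordSpan_eq_bot {x : Fin n → L} {β : Fin n → ℤ} (hβ : ∑ j, β j ≤ 0) :
    wordSpan K x β = ⊥ := by
  refine le_bot_iff.1 (wordSpan_le fun y hy => ?_)
  have := hy.one_le_sum
  lia

theorem lie_h_of_mem_wordSpan (H : ChevalleyRel A e f h) {β : Fin n → ℤ} {y : L}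
    (hy : y ∈ wordSpan K e β) (i : Fin n) : ⁅h i, y⁆ = (A *ᵥ β) i • y := by
  induction hy using Submodule.span_induction with
  | mem y hy => exact IsWord.lie_h H hy i
  | zero => simp
  | add y z _ _ ihy ihz => rw [lie_add, ihy, ihz, smul_add]
  | smul c y _ ih => rw [lie_smul, ih, smul_comm]

theorem IsWord.lie_f (H : ChevalleyRel A e f h) {β : Fin n → ℤ} {y : L} (hy : IsWord e β y)
    (i : Fin n) : (β = Pi.single i 1 ∧ y = e i) ∨ ⁅f i, y⁆ ∈ wordSpan K e (β - Pi.single i 1) := by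
  have hfe : ∀ k, ⁅f i, e k⁆ = if i = k then -h i else 0 := fun k => by
    simpa using H.swap.ef i k
  induction hy with
  | gen k =>
    by_cases hk : i = k
    · subst hk
      exact Or.inl ⟨rfl, rfl⟩
    · right
      rw [hfe, if_neg hk]
      exact zero_mem _
  | @lie k γ z hz ih =>
    right
    rw [leibniz_lie, hfe]
    refine add_mem ?_ ?_
    · split_ifs with hk
      · subst hk
        rw [add_sub_cancel_right, neg_lie, IsWord.lie_h H hz]
        exact neg_mem (zsmul_mem hz.mem _)
      · rw [zero_lie]
        exact zero_mem _
    · rcases ih with ⟨hγ, rfl⟩ | ih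
      · rw [hγ, add_sub_cancel_left, hfe, if_pos rfl, lie_neg, lie_skew, H.he]
        exact zsmul_mem (IsWord.gen k).mem _
      · have := lie_mem_wordSpan ih k
        rwa [sub_add_eq_add_sub] at this

/-- Away from the simple root `αᵢ` itself, `ad fᵢ` maps iterated brackets of the `eⱼ` to such. -/
theorem lie_f_mem_wordSpan (H : ChevalleyRel A e f h) {β : Fin n → ℤ} {y : L}
    (hy : y ∈ wordSpan K e β) {i : Fin n} (hβ : β ≠ Pi.single i 1) :
    ⁅f i, y⁆ ∈ wordSpan K e (β - Pi.single i 1) :=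
  lie_mem_of_forall_isWord _ (fun _ hz => (IsWord.lie_f H hz i).resolve_left fun h => hβ h.1) hy

variable (K) in
/-- The component of degree `β` of the Lie algebra generated by `eᵢ, fᵢ, hᵢ`: it is spanned by the
iterated brackets of the `eᵢ`, those of the `fᵢ`, and in degree zero the `hᵢ`. -/
def rootSpan (e f h : Fin n → L) (β : Fin n → ℤ) : Submodule K L :=
  wordSpan K e β ⊔ wordSpan K f (-β) ⊔ Submodule.span K {y | β = 0 ∧ y ∈ Set.range h}

theorem rootSpan_le {β : Fin n → ℤ} {S : Submodule K L} (he : ∀ y, IsWord e β y → y ∈ S)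
    (hf : ∀ y, IsWord f (-β) y → y ∈ S) (hh : β = 0 → ∀ i, h i ∈ S) :
    rootSpan K e f h β ≤ S :=
  sup_le (sup_le (wordSpan_le he) (wordSpan_le hf)) (Submodule.span_le.2 (by
    rintro _ ⟨hβ, i, rfl⟩
    exact hh hβ i))

theorem mem_rootSpan_e {β : Fin n → ℤ} {y : L} (hy : y ∈ wordSpan K e β) :
    y ∈ rootSpan K e f h β :=
  le_sup_left (a := wordSpan K e β ⊔ wordSpan K f (-β)) (le_sup_left (a := wordSpan K e β) hy)

theorem mem_rootSpan_f {β : Fin n → ℤ} {y : L} (hy : y ∈ wordSpan K f (-β)) :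
    y ∈ rootSpan K e f h β :=
  le_sup_left (a := wordSpan K e β ⊔ wordSpan K f (-β)) (le_sup_right (a := wordSpan K e β) hy)

theorem h_mem_rootSpan (i : Fin n) : h i ∈ rootSpan K e f h 0 :=
  le_sup_right (a := wordSpan K e 0 ⊔ wordSpan K f (-0)) (Submodule.subset_span ⟨rfl, i, rfl⟩)

theorem lie_mem_of_forall_rootSpan {β : Fin n → ℤ} {S : Submodule K L} (u : L)
    (he : ∀ y, IsWord e β y → ⁅u, y⁆ ∈ S) (hf : ∀ y, IsWord f (-β) y → ⁅u, y⁆ ∈ S)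
    (hh : β = 0 → ∀ i, ⁅u, h i⁆ ∈ S) {y : L} (hy : y ∈ rootSpan K e f h β) : ⁅u, y⁆ ∈ S :=
  rootSpan_le (S := S.comap (LieAlgebra.ad K L u : L →ₗ[K] L)) he hf hh hy

theorem rootSpan_swap (β : Fin n → ℤ) : rootSpan K f e (-h) β = rootSpan K e f h (-β) := by
  have key : ∀ (e f h : Fin n → L) (β : Fin n → ℤ),
      rootSpan K f e (-h) β ≤ rootSpan K e f h (-β) := by
    intro e f h β
    refine rootSpan_le (fun y hy => mem_rootSpan_f ?_) (fun y hy => mem_rootSpan_e hy.mem) ?_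
    · rw [neg_neg]
      exact hy.mem
    · rintro rfl i
      rw [neg_zero]
      exact neg_mem (h_mem_rootSpan i)
  refine le_antisymm (key e f h β) ?_
  have := key f e (-h) (-β)
  rwa [neg_neg, neg_neg] at this

theorem lie_e_mem_rootSpan (H : ChevalleyRel A e f h) {β : Fin n → ℤ} {y : L}
    (hy : y ∈ rootSpan K e f h β) (i : Fin n) :
    ⁅e i, y⁆ ∈ rootSpan K e f h (β + Pi.single i 1) := by
  refine lie_mem_of_forall_rootSpan (e i) (fun z hz => mem_rootSpan_e (hz.lie i).mem)
    (fun z hz => ?_) ?_ hy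
  · rcases IsWord.lie_f (K := K) H.swap hz i with ⟨hβ, rfl⟩ | hz
    · rw [H.ef, if_pos rfl, ← hβ, add_neg_cancel]
      exact h_mem_rootSpan i
    · refine mem_rootSpan_f ?_
      rwa [neg_add']
  · rintro rfl j
    rw [← lie_skew, H.he, zero_add]
    exact mem_rootSpan_e (neg_mem (zsmul_mem (IsWord.gen i).mem _))

theorem lie_f_mem_rootSpan (H : ChevalleyRel A e f h) {β : Fin n → ℤ} {y : L}
    (hy : y ∈ rootSpan K e f h β) (i : Fin n) :
    ⁅f i, y⁆ ∈ rootSpan K e f h (β - Pi.single i 1) := by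
  have := lie_e_mem_rootSpan (K := K) (β := -β) H.swap (by rwa [rootSpan_swap, neg_neg]) i
  rwa [rootSpan_swap, neg_add, neg_neg, ← sub_eq_add_neg] at this

theorem lie_h_of_mem_rootSpan (H : ChevalleyRel A e f h) {β : Fin n → ℤ} {y : L}
    (hy : y ∈ rootSpan K e f h β) (i : Fin n) : ⁅h i, y⁆ = (A *ᵥ β) i • y := by
  have : ⁅h i, y⁆ - (A *ᵥ β) i • y = 0 := by
    refine rootSpan_le (S := LinearMap.ker ((LieAlgebra.ad K L (h i) : L →ₗ[K] L) -
      (A *ᵥ β) i • LinearMap.id)) (fun z hz => ?_) (fun z hz => ?_) ?_ hy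
    · simp [IsWord.lie_h H hz i]
    · have := IsWord.lie_h H.swap hz i
      rw [Pi.neg_apply, neg_lie, Matrix.mulVec_neg, Pi.neg_apply, neg_smul, neg_inj] at this
      simp [this]
    · rintro rfl j
      simp [H.hh]
  rwa [sub_eq_zero] at this

theorem lie_h_mem_rootSpan (H : ChevalleyRel A e f h) {β : Fin n → ℤ} {y : L}
    (hy : y ∈ rootSpan K e f h β) (i : Fin n) : ⁅h i, y⁆ ∈ rootSpan K e f h β := by
  rw [lie_h_of_mem_rootSpan H hy]
  exact zsmul_mem hy _

end Words

/-! ### Degrees of the contragredient Lie algebra in the simply laced case -/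

section SimplyLaced

open Matrix

variable {n : ℕ} {K L : Type*} [Field K] [LieRing L] [LieAlgebra K L]
  {A : Matrix (Fin n) (Fin n) ℤ} {e f h : Fin n → L} {q : (Fin n → ℤ) → ℤ}

variable (K) in
/-- A combination of iterated brackets of the `eᵢ` of the same degree which is killed by all `ad fᵢ`
vanishes. -/
def Nondegenerate (e f : Fin n → L) : Prop :=
  ∀ (β : Fin n → ℤ) (x : L), x ∈ wordSpan K e β → (∀ i, ⁅f i, x⁆ = 0) → x = 0

/-- `A` is a simply laced Cartan matrix of finite type, and `q β = ½ βᵀ A β` is its quadratic form,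
which takes the value `1` at the simple roots. -/
structure IsSimplyLacedForm (A : Matrix (Fin n) (Fin n) ℤ) (q : (Fin n → ℤ) → ℤ) : Prop where
  zero : q 0 = 0
  pos : ∀ β, β ≠ 0 → 1 ≤ q β
  add_single : ∀ β i, q (β + Pi.single i 1) = q β + (A *ᵥ β) i + 1
  neg : ∀ β, q (-β) = q β
  diag : ∀ i, A i i = 2
  off_diag : ∀ i j, i ≠ j → A i j = 0 ∨ A i j = -1
  symm : ∀ i j, A i j = A j i
  finite : {β | q β ≤ 1}.Finite

namespace IsSimplyLacedForm

theorem single (Q : IsSimplyLacedForm A q) (i : Fin n) : q (Pi.single i 1) = 1 := by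
  have := Q.add_single 0 i
  simpa [Q.zero] using this

theorem sub_single (Q : IsSimplyLacedForm A q) (β : Fin n → ℤ) (i : Fin n) :
    q (β - Pi.single i 1) = q β - (A *ᵥ β) i + 1 := by
  have := Q.add_single (β - Pi.single i 1) i
  rw [sub_add_cancel, Matrix.mulVec_sub, Pi.sub_apply, mulVec_single_one_apply, Q.diag] at this
  lia

theorem mulVec_le_two (Q : IsSimplyLacedForm A q) {β : Fin n → ℤ} (hβ : q β = 1) (i : Fin n) :
    (A *ᵥ β) i ≤ 2 := by
  have h1 := Q.sub_single β i
  by_cases h0 : β - Pi.single i 1 = 0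
  · rw [h0, Q.zero] at h1
    lia
  · have := Q.pos _ h0
    lia

theorem eq_single_of_mulVec (Q : IsSimplyLacedForm A q) {β : Fin n → ℤ} (hβ : q β = 1)
    {i : Fin n} (hi : (A *ᵥ β) i = 2) : β = Pi.single i 1 := by
  by_contra h0
  have := Q.pos _ (sub_ne_zero.2 h0)
  rw [Q.sub_single] at this
  lia

theorem off_diag_le (Q : IsSimplyLacedForm A q) {i j : Fin n} (hij : i ≠ j) : A i j ≤ 0 := by
  rcases Q.off_diag i j hij with h | h <;> lia

end IsSimplyLacedForm

theorem ChevalleyRel.fe (H : ChevalleyRel A e f h) (i k : Fin n) :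
    ⁅f i, e k⁆ = if i = k then -h i else 0 := by
  simpa using H.swap.ef i k

/-- The Serre relation for orthogonal simple roots. -/
theorem Nondegenerate.lie_eq_zero (N : Nondegenerate K e f) (H : ChevalleyRel A e f h)
    {i j : Fin n} (h1 : A i j = 0) (h2 : A j i = 0) : ⁅e i, e j⁆ = 0 := by
  refine N _ _ ((IsWord.gen j).lie i).mem fun k => ?_
  rw [leibniz_lie, H.fe, H.fe]
  have h3 : ⁅(if k = i then -h k else 0), e j⁆ = 0 := by
    split_ifs with hk
    · subst hk
      rw [neg_lie, H.he, h1, zero_smul, neg_zero]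
    · exact zero_lie _
  have h4 : ⁅e i, (if k = j then -h k else 0)⁆ = 0 := by
    split_ifs with hk
    · subst hk
      rw [lie_neg, lie_skew, H.he, h2, zero_smul]
    · exact lie_zero _
  rw [h3, h4, add_zero]

/-- The Serre relation for simple roots connected by a single edge. -/
theorem Nondegenerate.lie_lie_eq_zero (N : Nondegenerate K e f) (H : ChevalleyRel A e f h)
    {i j : Fin n} (hd : A i i = 2) (h1 : A i j = -1) (h2 : A j i = -1) :
    ⁅e i, ⁅e i, e j⁆⁆ = 0 := by
  have hij : i ≠ j := by
    rintro rfl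
    lia
  refine N _ _ (((IsWord.gen j).lie i).lie i).mem fun k => ?_
  rw [leibniz_lie, leibniz_lie (f k) (e i) (e j), H.fe, H.fe]
  by_cases hki : k = i
  · subst hki
    rw [if_pos rfl, if_neg hij, lie_zero, add_zero, neg_lie, neg_lie, leibniz_lie, H.he, H.he, hd,
      h1, lie_neg, zsmul_lie, lie_zsmul]
    module
  · rw [if_neg hki, zero_lie, zero_lie, zero_add, zero_add]
    split_ifs with hkj
    · subst hkj
      rw [lie_neg (e i) (h k), lie_skew, H.he, h2, lie_zsmul, lie_self, smul_zero]
    · rw [lie_zero, lie_zero]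

/-- Let `y = [eₖ, w]` be an iterated bracket of degree `γ` with `q γ = 1` and `⟨γ, αⱼ^∨⟩ = 1`. If
all degrees up to the height of `γ` satisfy `q ≤ 1`, then `[eⱼ, y] = 0`. If `k = j`, then `[eⱼ, y]`
is killed by all `fᵢ`; if `αⱼ` is orthogonal to `αₖ`, then `[eⱼ, y] = [eₖ, [eⱼ, w]]`, and
`[eⱼ, w]` has a degree with `q ≥ 2`; if `αⱼ` is joined to `αₖ`, then `w = eⱼ`, and the assertion is
a Serre relation. -/
theorem lie_eq_zero_of_mulVec_eq_one (N : Nondegenerate K e f) (H : ChevalleyRel A e f h)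
    (Q : IsSimplyLacedForm A q) {γ : Fin n → ℤ} {y : L} (hy : IsWord e γ y) (hγ : q γ = 1)
    {j : Fin n} (hj : (A *ᵥ γ) j = 1)
    (ih : ∀ β : Fin n → ℤ, ∑ i, β i ≤ ∑ i, γ i → 2 ≤ q β → wordSpan K e β = ⊥) :
    ⁅e j, y⁆ = 0 := by
  rcases hy.cases_eq with ⟨k, rfl, rfl⟩ | ⟨k, δ, w, hw, rfl, rfl⟩
  · rw [mulVec_single_one_apply] at hj
    rcases eq_or_ne j k with rfl | hjk
    · have := Q.diag j
      lia
    · rcases Q.off_diag j k hjk with h | h <;> lia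
  · have hsum := sum_add_single δ k
    by_cases hδ2 : 2 ≤ q δ
    · have : w ∈ wordSpan K e δ := hw.mem
      rw [ih δ (by lia) hδ2, Submodule.mem_bot] at this
      rw [this, lie_zero, lie_zero]
    have hδ : q δ = 1 := le_antisymm (by lia) (Q.pos δ hw.ne_zero)
    have hkδ : (A *ᵥ δ) k = -1 := by
      have := Q.add_single δ k
      lia
    rw [Matrix.mulVec_add, Pi.add_apply, mulVec_single_one_apply] at hj
    rcases eq_or_ne j k with rfl | hjk
    · refine N _ _ ((hw.lie j).lie j).mem fun i => ?_
      rcases eq_or_ne i j with rfl | hij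
      · have hfw : ⁅e i, ⁅e i, ⁅f i, w⁆⁆⁆ = 0 := by
          have hne : δ ≠ Pi.single i 1 := by
            rintro rfl
            rw [mulVec_single_one_apply, Q.diag] at hkδ
            lia
          have h1 := lie_f_mem_wordSpan H hw.mem hne (K := K)
          rw [ih _ (by rw [sum_sub_single]; lia) (by rw [Q.sub_single]; lia),
            Submodule.mem_bot] at h1
          rw [h1, lie_zero, lie_zero]
        rw [leibniz_lie (f i), leibniz_lie (f i), H.fe, if_pos rfl, lie_add, hfw, neg_lie, neg_lie,
          IsWord.lie_h H (hw.lie i), IsWord.lie_h H hw, Matrix.mulVec_add, Pi.add_apply,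
          mulVec_single_one_apply, hkδ, Q.diag, lie_neg, lie_zsmul]
        module
      · have h1 := lie_f_mem_wordSpan (K := K) H ((hw.lie j).lie j).mem (i := i) (by
          intro h0
          have h2 := ((hw.lie j).lie j).one_le_sum
          have h3 := sum_add_single (δ + Pi.single j 1) j
          have h4 := hw.one_le_sum
          have h5 : ∑ k, (Pi.single i 1 : Fin n → ℤ) k = 1 := by simp
          rw [h0] at h3
          lia)
        rw [ih _ (by rw [sum_sub_single, sum_add_single]; lia) ?_, Submodule.mem_bot] at h1
        · exact h1
        · rw [Q.sub_single, Q.add_single, Q.add_single]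
          simp only [Matrix.mulVec_add, Pi.add_apply, mulVec_single_one_apply, Q.diag]
          have := Q.mulVec_le_two hδ i
          have := Q.off_diag_le hij
          lia
    · rcases Q.off_diag j k hjk with h0 | h1
      -- Here `⟨δ, αⱼ^∨⟩ = 1`, hence `q (δ + αⱼ) = 3`.
      · have h2 := lie_mem_wordSpan (K := K) hw.mem j
        rw [ih _ (by rw [sum_add_single]; lia) (by rw [Q.add_single]; lia),
          Submodule.mem_bot] at h2
        rw [leibniz_lie, N.lie_eq_zero H h0 (by rw [Q.symm]; exact h0), zero_lie, h2, lie_zero,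
          add_zero]
      -- Here `⟨δ, αⱼ^∨⟩ = 2`, hence `δ = αⱼ`.
      · have h2 := Q.eq_single_of_mulVec hδ (i := j) (by lia)
        subst h2
        rw [hw.eq_gen, ← lie_skew (e k), lie_neg,
          N.lie_lie_eq_zero H (Q.diag j) h1 (by rw [Q.symm]; exact h1), neg_zero]

/-- Every degree `β` of the positive part satisfies `q β ≤ 1`. The proof is by induction on the
height. Let `[eⱼ, y]` have degree `β = γ + αⱼ` with `q γ = 1` and `q β ≥ 2`, that is,
`⟨γ, αⱼ^∨⟩ ≥ 0`. If `⟨γ, αⱼ^∨⟩ = 2`, then `γ = αⱼ` and the bracket is `[eⱼ, eⱼ]`; the value `1` is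
`lie_eq_zero_of_mulVec_eq_one`; for the value `0`, the brackets `[fᵢ, [eⱼ, y]]` have degrees with
`q ≥ 2` and smaller height, or vanish for reasons of weight, so that nondegeneracy applies. -/
theorem wordSpan_eq_bot_of_two_le (N : Nondegenerate K e f) (H : ChevalleyRel A e f h)
    (Q : IsSimplyLacedForm A q) {β : Fin n → ℤ} (hβ : 2 ≤ q β) : wordSpan K e β = ⊥ := by
  suffices key : ∀ (m : ℕ) (β : Fin n → ℤ), ∑ i, β i ≤ m → 2 ≤ q β → wordSpan K e β = ⊥ from
    key (∑ i, β i).toNat β (Int.self_le_toNat _) hβ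
  intro m
  induction m with
  | zero => exact fun β hm _ => wordSpan_eq_bot (by exact_mod_cast hm)
  | succ m ih =>
    intro β hm hβ
    refine le_bot_iff.1 (wordSpan_le fun x hx => ?_)
    rw [Submodule.mem_bot]
    rcases hx.cases_eq with ⟨k, rfl, rfl⟩ | ⟨j, γ, y, hy, rfl, rfl⟩
    · rw [Q.single] at hβ
      lia
    rw [sum_add_single] at hm
    push_cast at hm
    by_cases hγ2 : 2 ≤ q γ
    · have : y ∈ wordSpan K e γ := hy.mem
      rw [ih γ (by lia) hγ2, Submodule.mem_bot] at this
      rw [this, lie_zero]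
    have hγ : q γ = 1 := le_antisymm (by lia) (Q.pos γ hy.ne_zero)
    have hqβ := Q.add_single γ j
    have hle := Q.mulVec_le_two hγ j
    rcases (by lia : (A *ᵥ γ) j = 2 ∨ (A *ᵥ γ) j = 1 ∨ (A *ᵥ γ) j = 0) with h2 | h1 | h0
    · obtain rfl := Q.eq_single_of_mulVec hγ h2
      rw [hy.eq_gen, lie_self]
    · exact lie_eq_zero_of_mulVec_eq_one N H Q hy hγ h1 fun β hβ hq => ih β (by lia) hq
    · rcases hy.cases_eq with ⟨k, rfl, rfl⟩ | ⟨k, δ, w, hw, hδ, -⟩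
      · rw [mulVec_single_one_apply] at h0
        exact N.lie_eq_zero H h0 (by rw [Q.symm]; exact h0)
      · have hne : ∀ i, γ ≠ Pi.single i 1 := by
          rintro i rfl
          have h3 := sum_add_single δ k
          have h4 := hw.one_le_sum
          rw [← hδ] at h3
          simp at h3
          lia
        have hfy : ∀ i, (A *ᵥ γ) i ≤ 0 → ⁅f i, y⁆ = 0 := fun i hi => by
          have h3 := lie_f_mem_wordSpan (K := K) H hy.mem (hne i)
          rwa [ih _ (by rw [sum_sub_single]; lia) (by rw [Q.sub_single]; lia),
            Submodule.mem_bot] at h3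
        refine N _ _ (hy.lie j).mem fun i => ?_
        rcases eq_or_ne i j with rfl | hij
        · rw [leibniz_lie, H.fe, if_pos rfl, neg_lie, IsWord.lie_h H hy, h0, zero_smul,
            hfy i h0.le, lie_zero, neg_zero, add_zero]
        · rw [leibniz_lie, H.fe, if_neg hij, zero_lie, zero_add]
          by_cases hi : (A *ᵥ γ) i ≤ 0
          · rw [hfy i hi, lie_zero]
          · have hi1 : (A *ᵥ γ) i ≠ 2 := fun h2 => hne i (Q.eq_single_of_mulVec hγ h2)
            have h3 := lie_mem_wordSpan (lie_f_mem_wordSpan (K := K) H hy.mem (hne i)) j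
            rw [ih _ (by rw [sum_add_single, sum_sub_single]; lia) ?_, Submodule.mem_bot] at h3
            · exact h3
            · rw [sub_add_eq_add_sub, Q.sub_single, Matrix.mulVec_add, Pi.add_apply,
                mulVec_single_one_apply]
              have := Q.off_diag_le hij
              have := Q.mulVec_le_two hγ i
              lia

/-- Every degree `β` satisfies `q β ≤ 1`. -/
theorem rootSpan_eq_bot_of_two_le (N : Nondegenerate K e f) (N' : Nondegenerate K f e)
    (H : ChevalleyRel A e f h) (Q : IsSimplyLacedForm A q) {β : Fin n → ℤ} (hβ : 2 ≤ q β) :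
    rootSpan K e f h β = ⊥ := by
  refine le_bot_iff.1 (rootSpan_le (fun y hy => ?_) (fun y hy => ?_) ?_)
  · rw [← wordSpan_eq_bot_of_two_le N H Q hβ]
    exact hy.mem
  · rw [← wordSpan_eq_bot_of_two_le (β := -β) N' H.swap Q (by rwa [Q.neg])]
    exact hy.mem
  · rintro rfl
    rw [Q.zero] at hβ
    lia

/-- On elements of degree `β ≠ -αᵢ`, `(ad eᵢ)²` vanishes: by convexity of `q` along the line
`β + ℤ αᵢ`, one of `β`, `β + αᵢ`, `β + 2 αᵢ` is not a degree. -/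
theorem lie_lie_e_eq_zero (N : Nondegenerate K e f) (N' : Nondegenerate K f e)
    (H : ChevalleyRel A e f h) (Q : IsSimplyLacedForm A q) {β : Fin n → ℤ} {i : Fin n}
    (hβ : β ≠ -Pi.single i 1) {y : L} (hy : y ∈ rootSpan K e f h β) : ⁅e i, ⁅e i, y⁆⁆ = 0 := by
  have hpos := Q.pos (β + Pi.single i 1) fun h0 => hβ (eq_neg_of_add_eq_zero_left h0)
  have h1 := Q.add_single β i
  have h2 := Q.add_single (β + Pi.single i 1) i
  rw [Matrix.mulVec_add, Pi.add_apply, mulVec_single_one_apply, Q.diag] at h2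
  have hy2 := lie_e_mem_rootSpan H (lie_e_mem_rootSpan H hy i) i
  by_cases hq : 2 ≤ q β
  · rw [rootSpan_eq_bot_of_two_le N N' H Q hq, Submodule.mem_bot] at hy
    rw [hy, lie_zero, lie_zero]
  · rwa [rootSpan_eq_bot_of_two_le N N' H Q (by lia), Submodule.mem_bot] at hy2

theorem exists_smul_f_of_mem_rootSpan {i : Fin n} {y : L}
    (hy : y ∈ rootSpan K e f h (-Pi.single i 1)) : ∃ c : K, y = c • f i := by
  have : rootSpan K e f h (-Pi.single i 1) ≤ Submodule.span K {f i} := by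
    refine rootSpan_le (fun z hz => ?_) (fun z hz => ?_) ?_
    · have := hz.one_le_sum
      simp at this
    · rw [neg_neg] at hz
      rw [hz.eq_gen]
      exact Submodule.mem_span_singleton_self _
    · intro h0
      have := congrFun h0 i
      simp at this
  obtain ⟨c, rfl⟩ := Submodule.mem_span_singleton.1 (this hy)
  exact ⟨c, rfl⟩

theorem iSup_rootSpan_induction (hT : ⨆ β, rootSpan K e f h β = ⊤) {p : L → Prop}
    (hmem : ∀ β, ∀ y ∈ rootSpan K e f h β, p y) (hzero : p 0)
    (hadd : ∀ y z, p y → p z → p (y + z)) (y : L) : p y :=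
  Submodule.iSup_induction _ (motive := p) (by rw [hT]; trivial) hmem hzero hadd

/-- The identities of `IsExpNilpotent` hold for `eᵢ`, because the image of `(ad eᵢ)²` is contained
in `K eᵢ` and all degrees other than `-αᵢ` are killed by `(ad eᵢ)²`. -/
theorem isExpNilpotent_e (N : Nondegenerate K e f) (N' : Nondegenerate K f e)
    (H : ChevalleyRel A e f h) (Q : IsSimplyLacedForm A q) (hT : ⨆ β, rootSpan K e f h β = ⊤)
    (i : Fin n) : IsExpNilpotent (e i) := by
  -- `(ad eᵢ)² fᵢ = -2 eᵢ`, and `fᵢ` spans the component of degree `-αᵢ`.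
  have hff : ⁅e i, ⁅e i, f i⁆⁆ = -((2 : ℤ) • e i) := by
    rw [H.ef, if_pos rfl, ← lie_skew, H.he, Q.diag]
  have hsq : ∀ y, ∃ c : K, ⁅e i, ⁅e i, y⁆⁆ = c • e i := by
    refine iSup_rootSpan_induction hT (fun β y hy => ?_) ⟨0, by simp⟩ ?_
    · rcases eq_or_ne β (-Pi.single i 1) with rfl | hβ
      · obtain ⟨c, rfl⟩ := exists_smul_f_of_mem_rootSpan hy
        refine ⟨-(2 * c), ?_⟩
        rw [lie_smul, lie_smul, hff]
        module
      · exact ⟨0, by rw [lie_lie_e_eq_zero N N' H Q hβ hy, zero_smul]⟩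
    · rintro y z ⟨c, hc⟩ ⟨d, hd⟩
      exact ⟨c + d, by rw [lie_add, lie_add, hc, hd, add_smul]⟩
  refine ⟨fun y => ?_, ?_, fun y z => ?_⟩
  · obtain ⟨c, hc⟩ := hsq y
    rw [hc, lie_smul, lie_self, smul_zero]
  · refine iSup_rootSpan_induction hT (fun β y hy => ?_) (by simp) ?_
    · refine iSup_rootSpan_induction hT (fun γ z hz => ?_) (by simp) ?_
      · rcases eq_or_ne β (-Pi.single i 1) with rfl | hβ
        · obtain ⟨c, rfl⟩ := exists_smul_f_of_mem_rootSpan hy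
          rcases eq_or_ne γ (-Pi.single i 1) with rfl | hγ
          · obtain ⟨d, rfl⟩ := exists_smul_f_of_mem_rootSpan hz
            simp only [lie_smul, smul_lie]
            rw [← lie_skew, ← smul_add, ← smul_add, neg_add_cancel, smul_zero, smul_zero]
          · rw [lie_lie_e_eq_zero N N' H Q hγ hz, lie_zero, zero_add, lie_smul, lie_smul, hff,
              smul_lie, neg_lie, zsmul_lie, lie_lie_e_eq_zero N N' H Q hγ hz, smul_zero, neg_zero,
              smul_zero]
        · rw [lie_lie_e_eq_zero N N' H Q hβ hy, zero_lie, add_zero]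
          rcases eq_or_ne γ (-Pi.single i 1) with rfl | hγ
          · obtain ⟨d, rfl⟩ := exists_smul_f_of_mem_rootSpan hz
            rw [lie_smul, lie_smul, hff, lie_smul, lie_neg, lie_zsmul, ← lie_skew,
              lie_lie_e_eq_zero N N' H Q hβ hy, neg_zero, smul_zero, neg_zero, smul_zero]
          · rw [lie_lie_e_eq_zero N N' H Q hγ hz, lie_zero]
      · intro z w hz hw
        rw [lie_add, lie_add, lie_add, lie_add, add_add_add_comm, hz, hw, add_zero]
    · intro y z hy hz w
      rw [lie_add, lie_add, add_lie, add_lie, add_add_add_comm, hy, hz, add_zero]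
  · obtain ⟨c, hc⟩ := hsq y
    obtain ⟨d, hd⟩ := hsq z
    rw [hc, hd, lie_smul, smul_lie, lie_self, smul_zero, smul_zero]

theorem iSup_rootSpan_swap (hT : ⨆ β, rootSpan K e f h β = ⊤) :
    ⨆ β, rootSpan K f e (-h) β = ⊤ := by
  rw [← hT]
  simp_rw [rootSpan_swap]
  exact (Equiv.neg (Fin n → ℤ)).iSup_congr fun _ => rfl

theorem isExpNilpotent_f (N : Nondegenerate K e f) (N' : Nondegenerate K f e)
    (H : ChevalleyRel A e f h) (Q : IsSimplyLacedForm A q) (hT : ⨆ β, rootSpan K e f h β = ⊤)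
    (i : Fin n) : IsExpNilpotent (f i) :=
  isExpNilpotent_e N' N H.swap Q (iSup_rootSpan_swap hT) i

/-- Orthogonal simple roots: `(ad eᵢ)² ad eⱼ = 0`, because `αᵢ + αⱼ` is not a root. -/
theorem lie_lie_e_lie_e_eq_zero (N : Nondegenerate K e f) (N' : Nondegenerate K f e)
    (H : ChevalleyRel A e f h) (Q : IsSimplyLacedForm A q) (hT : ⨆ β, rootSpan K e f h β = ⊤)
    {i j : Fin n} (hij : A i j = 0) (y : L) : ⁅e i, ⁅e i, ⁅e j, y⁆⁆⁆ = 0 := by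
  revert y
  refine iSup_rootSpan_induction hT (fun β y hy => ?_) (by simp) ?_
  · by_cases hβ : β + Pi.single j 1 = -Pi.single i 1
    · have hβ' : 2 ≤ q β := by
        obtain rfl : β = -(Pi.single j 1 + Pi.single i 1) := by
          rw [neg_add_rev, ← sub_eq_add_neg]
          exact eq_sub_of_add_eq hβ
        rw [Q.neg, Q.add_single, Q.single, mulVec_single_one_apply, hij]
        norm_num
      rw [rootSpan_eq_bot_of_two_le N N' H Q hβ', Submodule.mem_bot] at hy
      rw [hy, lie_zero, lie_zero, lie_zero]
    · exact lie_lie_e_eq_zero N N' H Q hβ (lie_e_mem_rootSpan H hy j)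
  · intro y z hy hz
    simp only [lie_add, hy, hz, add_zero]

theorem finiteDimensional_rootSpan (β : Fin n → ℤ) :
    FiniteDimensional K (rootSpan K e f h β) := by
  have h1 : FiniteDimensional K (wordSpan K e β) :=
    FiniteDimensional.span_of_finite K (finite_setOf_isWord e β)
  have h2 : FiniteDimensional K (wordSpan K f (-β)) :=
    FiniteDimensional.span_of_finite K (finite_setOf_isWord f (-β))
  have h3 : FiniteDimensional K (Submodule.span K {y | β = 0 ∧ y ∈ Set.range h}) :=
    FiniteDimensional.span_of_finite K ((Set.finite_range h).subset fun y hy => hy.2)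
  unfold rootSpan
  infer_instance

theorem finite_of_finite_degrees {S : Set (Fin n → ℤ)} (hS : S.Finite)
    (hT : ⨆ β, rootSpan K e f h β = ⊤) (h0 : ∀ β ∉ S, rootSpan K e f h β = ⊥) :
    Module.Finite K L := by
  have : Finite S := hS
  have hle : (⊤ : Submodule K L) ≤ ⨆ β : S, rootSpan K e f h β := by
    rw [← hT]
    refine iSup_le fun β => ?_
    by_cases hβ : β ∈ S
    · exact le_iSup (fun β : S => rootSpan K e f h β) ⟨β, hβ⟩
    · rw [h0 β hβ]
      exact bot_le
  have hfin : ∀ β : S, FiniteDimensional K (rootSpan K e f h β) :=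
    fun β => finiteDimensional_rootSpan (β : Fin n → ℤ)
  have : FiniteDimensional K (⨆ β : S, rootSpan K e f h β : Submodule K L) :=
    Submodule.finite_iSup _
  rw [top_le_iff.1 hle] at this
  exact Module.finite_def.2 (Module.Finite.iff_fg.1 this)

end SimplyLaced

end ExcLie

noncomputable section

namespace ExcLie

/-! ### The Lie algebra `g̃(A)` and its Verma modules -/

section Tilde

open Matrix CartanMatrix

variable {K : Type*} [Field K] {n : ℕ} {A : Matrix (Fin n) (Fin n) ℤ}
  {L : Type*} [LieRing L] [LieAlgebra K L]

theorem tildeGen_mem_eq_zero {x : FreeLieAlgebra K (Generators (Fin n))}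
    (hx : x ∈ tildeRelations K A) :
    (LieSubmodule.Quotient.mk x : GTilde K A) = 0 :=
  LieSubmodule.Quotient.mk_eq_zero'.2 (LieSubmodule.subset_lieSpan hx)

variable (K A) in
/-- The generators of `g̃(A)` satisfy the Chevalley relations. -/
theorem chevalleyRel_tilde : ChevalleyRel A (fun i => tildeGen K A (Generators.E i))
    (fun i => tildeGen K A (Generators.F i)) (fun i => tildeGen K A (Generators.H i)) where
  hh i j := tildeGen_mem_eq_zero (x := Relations.HH K (i, j))
    (Or.inl (Or.inl (Or.inl ⟨(i, j), rfl⟩)))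
  ef i j := by
    have := tildeGen_mem_eq_zero (K := K) (A := A) (x := Relations.EF K (i, j))
      (Or.inl (Or.inl (Or.inr ⟨(i, j), rfl⟩)))
    by_cases hij : i = j
    · subst hij
      rw [if_pos rfl]
      simp only [Relations.EF, Function.uncurry_apply_pair, if_true] at this
      exact sub_eq_zero.1 this
    · rw [if_neg hij]
      simp only [Relations.EF, Function.uncurry_apply_pair, if_neg hij] at this
      exact this
  he i j := sub_eq_zero.1 (tildeGen_mem_eq_zero (x := Relations.HE K A (i, j))
    (Or.inl (Or.inr ⟨(i, j), rfl⟩)))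
  hf i j := eq_neg_of_add_eq_zero_left (tildeGen_mem_eq_zero (x := Relations.HF K A (i, j))
    (Or.inr ⟨(i, j), rfl⟩))

/-- The values on the generators of a homomorphism `g̃(A) → L`. -/
def genMap (e f h : Fin n → L) : Generators (Fin n) → L
  | Generators.H i => h i
  | Generators.E i => e i
  | Generators.F i => f i

theorem lieSpan_le_ker_lift {e f h : Fin n → L} (H : ChevalleyRel A e f h) :
    LieSubmodule.lieSpan K (FreeLieAlgebra K (Generators (Fin n))) (tildeRelations K A) ≤
      (FreeLieAlgebra.lift K (genMap e f h)).ker := by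
  rw [LieSubmodule.lieSpan_le]
  rintro _ (((⟨⟨i, j⟩, rfl⟩ | ⟨⟨i, j⟩, rfl⟩) | ⟨⟨i, j⟩, rfl⟩) | ⟨⟨i, j⟩, rfl⟩)
  · simp [Relations.HH, genMap, H.hh]
  · by_cases hij : i = j
    · subst hij
      simp [Relations.EF, genMap, H.ef]
    · simp [Relations.EF, genMap, H.ef, hij]
  · simp [Relations.HE, genMap, H.he]
  · simp [Relations.HF, genMap, H.hf]

/-- The universal property of `g̃(A)`. -/
def tildeLift {e f h : Fin n → L} (H : ChevalleyRel A e f h) : GTilde K A →ₗ⁅K⁆ L :=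
  { Submodule.liftQ _ (FreeLieAlgebra.lift K (genMap e f h) :
      FreeLieAlgebra K (Generators (Fin n)) →ₗ[K] L) (lieSpan_le_ker_lift (K := K) H) with
    map_lie' := by
      intro x y
      induction x using Submodule.Quotient.induction_on
      induction y using Submodule.Quotient.induction_on
      exact LieHom.map_lie (FreeLieAlgebra.lift K (genMap e f h)) _ _ }

theorem tildeLift_gen {e f h : Fin n → L} (H : ChevalleyRel A e f h)
    (x : Generators (Fin n)) : tildeLift (K := K) H (tildeGen K A x) = genMap e f h x :=
  FreeLieAlgebra.lift_of_apply _ x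

/-- The algebra `g̃(A)` is generated by the symbols `hᵢ, eᵢ, fᵢ`. -/
theorem lieSubalgebra_eq_top {S : LieSubalgebra K (GTilde K A)} (hS : ∀ x, tildeGen K A x ∈ S) :
    S = ⊤ := by
  have key : S.incl.comp (FreeLieAlgebra.lift K fun x => (⟨tildeGen K A x, hS x⟩ : S)) =
      FreeLieAlgebra.lift K (tildeGen K A) := by
    apply FreeLieAlgebra.hom_ext
    intro x
    simp
  let mkHom : FreeLieAlgebra K (Generators (Fin n)) →ₗ⁅K⁆ GTilde K A :=
    { toFun := LieSubmodule.Quotient.mk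
      map_add' := fun _ _ => rfl
      map_smul' := fun _ _ => rfl
      map_lie' := rfl }
  have key2 : mkHom = FreeLieAlgebra.lift K (tildeGen K A) := by
    apply FreeLieAlgebra.hom_ext
    intro x
    rw [FreeLieAlgebra.lift_of_apply]
    rfl
  rw [eq_top_iff]
  rintro x -
  obtain ⟨x, rfl⟩ := LieSubmodule.Quotient.surjective_mk' _ x
  have h1 : mkHom x ∈ S := by
    rw [key2, ← key]
    exact (FreeLieAlgebra.lift K (fun x => (⟨tildeGen K A x, hS x⟩ : S)) x).2
  exact h1

section Verma

attribute [local instance 100] LieRing.ofAssociativeRing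

theorem lie_end_apply {V : Type*} [AddCommGroup V] [Module K V] (S T : Module.End K V) (v : V) :
    ⁅S, T⁆ v = S (T v) - T (S v) := rfl

variable (A) (w : Fin n → K)

/-- The weight of `hᵢ` on the vector `f_{l₁} f_{l₂} ⋯ v` of the Verma module with highest weight
`w`. -/
def vermaWeight (i : Fin n) (l : List (Fin n)) : K := w i - ((l.map (A i)).sum : ℤ)

/-- The action of `fⱼ` on the Verma module of `g̃(A)`, which is free over the free algebra on the
`fⱼ`: it has a basis indexed by lists, the list `[j, k, …]` standing for `fⱼ fₖ ⋯ v`. -/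
def vermaF (j : Fin n) : Module.End K (List (Fin n) →₀ K) :=
  Finsupp.linearCombination K fun l => Finsupp.single (j :: l) 1

/-- The action of `hᵢ` on the Verma module. -/
def vermaH (i : Fin n) : Module.End K (List (Fin n) →₀ K) :=
  Finsupp.linearCombination K fun l => vermaWeight A w i l • Finsupp.single l 1

/-- The action of `eᵢ` on the basis vectors of the Verma module, determined by `eᵢ v = 0` and
`[eᵢ, fⱼ] = δᵢⱼ hᵢ`. -/
def vermaEAux (i : Fin n) : List (Fin n) → (List (Fin n) →₀ K)
  | [] => 0
  | j :: l => vermaF j (vermaEAux i l) +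
      if i = j then vermaWeight A w i l • Finsupp.single l 1 else 0

/-- The action of `eᵢ` on the Verma module. -/
def vermaE (i : Fin n) : Module.End K (List (Fin n) →₀ K) :=
  Finsupp.linearCombination K (vermaEAux A w i)

variable {A w}

theorem vermaF_single (j : Fin n) (l : List (Fin n)) :
    vermaF (K := K) j (Finsupp.single l 1) = Finsupp.single (j :: l) 1 := by
  simp [vermaF]

theorem vermaH_single (i : Fin n) (l : List (Fin n)) :
    vermaH A w i (Finsupp.single l 1) = vermaWeight A w i l • Finsupp.single l 1 := by
  simp [vermaH]

theorem vermaE_single (i : Fin n) (l : List (Fin n)) :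
    vermaE A w i (Finsupp.single l 1) = vermaEAux A w i l := by
  simp [vermaE]

theorem vermaWeight_cons (i j : Fin n) (l : List (Fin n)) :
    vermaWeight A w i (j :: l) = vermaWeight A w i l - (A i j : K) := by
  simp only [vermaWeight, List.map_cons, List.sum_cons, Int.cast_add]
  ring

theorem verma_ext {S T : Module.End K (List (Fin n) →₀ K)}
    (h : ∀ l, S (Finsupp.single l 1) = T (Finsupp.single l 1)) : S = T :=
  Finsupp.basisSingleOne.ext fun l => by simpa using h l

theorem verma_hf (i j : Fin n) : ⁅vermaH A w i, vermaF j⁆ = -(A i j • vermaF (K := K) j) := by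
  refine verma_ext fun l => ?_
  simp only [lie_end_apply, vermaF_single, vermaH_single, map_smul,
    LinearMap.neg_apply, LinearMap.smul_apply, vermaWeight_cons, ← Int.cast_smul_eq_zsmul K]
  module

theorem verma_ef (i j : Fin n) :
    ⁅vermaE A w i, vermaF j⁆ = if i = j then vermaH A w i else 0 := by
  refine verma_ext fun l => ?_
  simp only [lie_end_apply, vermaF_single, vermaE_single, vermaEAux,
    add_sub_cancel_left]
  split_ifs
  · rw [vermaH_single]
  · rfl

theorem vermaH_vermaEAux (i j : Fin n) (l : List (Fin n)) :
    vermaH A w i (vermaEAux A w j l) =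
      (vermaWeight A w i l + (A i j : K)) • vermaEAux A w j l := by
  induction l with
  | nil => simp [vermaEAux]
  | cons k l ih =>
    have hHF : ∀ v, vermaH A w i (vermaF k v) =
        vermaF k (vermaH A w i v) - (A i k : K) • vermaF k v := fun v => by
      have := LinearMap.congr_fun (verma_hf (A := A) (w := w) i k) v
      simp only [lie_end_apply, LinearMap.neg_apply,
        LinearMap.smul_apply, ← Int.cast_smul_eq_zsmul K] at this
      rw [sub_eq_iff_eq_add] at this
      rw [this]
      abel
    rw [vermaEAux, map_add, hHF, ih, map_smul, vermaWeight_cons, smul_add]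
    split_ifs with hjk
    · subst hjk
      rw [map_smul, vermaH_single]
      module
    · rw [map_zero]
      module

variable (A w) in
/-- The operators on the Verma module satisfy the Chevalley relations. -/
theorem chevalleyRel_verma : ChevalleyRel A (vermaE A w) (vermaF (K := K)) (vermaH A w) where
  hh i j := by
    refine verma_ext fun l => ?_
    simp only [lie_end_apply, vermaH_single, map_smul,
      LinearMap.zero_apply]
    module
  ef := verma_ef
  he i j := by
    refine verma_ext fun l => ?_
    simp only [lie_end_apply, vermaH_single, vermaE_single, map_smul,
      LinearMap.smul_apply, vermaH_vermaEAux, ← Int.cast_smul_eq_zsmul K]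
    module
  hf := verma_hf

variable (A w) in
/-- The action of `g̃(A)` on the Verma module. -/
def vermaRep : GTilde K A →ₗ⁅K⁆ Module.End K (List (Fin n) →₀ K) :=
  tildeLift (chevalleyRel_verma A w)

theorem vermaRep_lie (x y : GTilde K A) (v : List (Fin n) →₀ K) :
    vermaRep A w ⁅x, y⁆ v =
      vermaRep A w x (vermaRep A w y v) - vermaRep A w y (vermaRep A w x v) := by
  rw [LieHom.map_lie]
  rfl

variable (K A) in
/-- The Harish-Chandra projection of `g̃(A)` onto its Cartan subalgebra, the latter being viewed as
a space of functions on weights: the value of `x` at the weight `w` is the coefficient of the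
highest weight vector `v` in `x v`. -/
def harishChandra : GTilde K A →ₗ[K] ((Fin n → K) → K) :=
  LinearMap.pi fun w => Finsupp.lapply [] ∘ₗ LinearMap.applyₗ (Finsupp.single [] (1 : K)) ∘ₗ
    (vermaRep A w : GTilde K A →ₗ[K] Module.End K (List (Fin n) →₀ K))

theorem harishChandra_apply (x : GTilde K A) (w : Fin n → K) :
    harishChandra K A x w = vermaRep A w x (Finsupp.single [] 1) [] := rfl

theorem harishChandra_h (i : Fin n) (w : Fin n → K) :
    harishChandra K A (tildeGen K A (Generators.H i)) w = w i := by
  rw [harishChandra_apply, vermaRep, tildeLift_gen, genMap, vermaH_single]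
  simp [vermaWeight]

theorem harishChandra_word_e {β : Fin n → ℤ} {y : GTilde K A}
    (hy : IsWord (fun i => tildeGen K A (Generators.E i)) β y) : harishChandra K A y = 0 := by
  funext w
  rw [harishChandra_apply]
  suffices h : vermaRep A w y (Finsupp.single [] 1) = 0 by rw [h]; rfl
  induction hy with
  | gen i =>
    rw [vermaRep, tildeLift_gen, genMap, vermaE_single, vermaEAux]
  | lie i _ ih =>
    rw [vermaRep_lie, ih, map_zero, zero_sub, vermaRep, tildeLift_gen, genMap, vermaE_single,
      vermaEAux, map_zero, neg_zero]

theorem harishChandra_word_f {β : Fin n → ℤ} {y : GTilde K A}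
    (hy : IsWord (fun i => tildeGen K A (Generators.F i)) β y) : harishChandra K A y = 0 := by
  funext w
  rw [harishChandra_apply]
  have hF : ∀ (j : Fin n) (v : List (Fin n) →₀ K), vermaF j v [] = 0 := fun j v => by
    induction v using Finsupp.induction_linear with
    | zero => simp
    | add v v' hv hv' => rw [map_add, Finsupp.add_apply, hv, hv', add_zero]
    | single l c => simp [vermaF]
  suffices h : ∀ v, vermaRep A w y v [] = 0 from h _
  induction hy with
  | gen i =>
    intro v
    rw [vermaRep, tildeLift_gen, genMap, hF]
  | lie i _ ih =>
    intro v
    rw [vermaRep_lie, Finsupp.sub_apply, ih, sub_zero, vermaRep, tildeLift_gen, genMap, hF]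

end Verma

theorem eq_zero_of_harishChandra_eq_zero {c : Fin n → K}
    (hc : harishChandra K A (∑ i, c i • tildeGen K A (Generators.H i)) = 0) : c = 0 := by
  funext i
  have := congrFun hc (Pi.single i 1)
  rw [map_sum, Finset.sum_apply] at this
  simpa [harishChandra_h, Pi.single_apply] using this

theorem mem_tildeCartan {x : GTilde K A} (hx : x ∈ tildeCartan K A) :
    ∃ c : Fin n → K, x = ∑ i, c i • tildeGen K A (Generators.H i) := by
  obtain ⟨c, hc⟩ := (Submodule.mem_span_range_iff_exists_fun K).1 hx
  exact ⟨c, hc.symm⟩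

/-- The Harish-Chandra projection is injective on the Cartan subalgebra. -/
theorem eq_zero_of_mem_tildeCartan {x : GTilde K A} (hx : x ∈ tildeCartan K A)
    (h0 : harishChandra K A x = 0) : x = 0 := by
  obtain ⟨c, rfl⟩ := mem_tildeCartan hx
  rw [eq_zero_of_harishChandra_eq_zero h0]
  simp

end Tilde

/-! ### The maximal ideal and nondegeneracy -/

section Maximal

open CartanMatrix

variable {K : Type*} [Field K] {n : ℕ} {A : Matrix (Fin n) (Fin n) ℤ}

variable (K A) in
/-- The generators `eᵢ` of `g̃(A)`. -/
abbrev tildeE (i : Fin n) : GTilde K A := tildeGen K A (Generators.E i)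

variable (K A) in
/-- The generators `fᵢ` of `g̃(A)`. -/
abbrev tildeF (i : Fin n) : GTilde K A := tildeGen K A (Generators.F i)

variable (K A) in
/-- The generators `hᵢ` of `g̃(A)`. -/
abbrev tildeH (i : Fin n) : GTilde K A := tildeGen K A (Generators.H i)

/-- The triangular decomposition of `g̃(A)`: homogeneous elements lie in the span of iterated
brackets of the given degree. -/
theorem TildeHom.mem_rootSpan {α : Fin n → ℤ} {x : GTilde K A} (hx : TildeHom K A α x) :
    x ∈ rootSpan K (tildeE K A) (tildeF K A) (tildeH K A) α := by
  suffices h : x ∈ rootSpan K (tildeE K A) (tildeF K A) (tildeH K A) α ∧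
      ∀ β, ∀ y ∈ rootSpan K (tildeE K A) (tildeF K A) (tildeH K A) β,
        ⁅x, y⁆ ∈ rootSpan K (tildeE K A) (tildeF K A) (tildeH K A) (α + β) from h.1
  have H := chevalleyRel_tilde K A
  induction hx with
  | h i =>
    refine ⟨h_mem_rootSpan i, fun β y hy => ?_⟩
    rw [zero_add]
    exact lie_h_mem_rootSpan H hy i
  | e i =>
    refine ⟨mem_rootSpan_e (IsWord.gen i).mem, fun β y hy => ?_⟩
    rw [add_comm]
    exact lie_e_mem_rootSpan H hy i
  | f i =>
    refine ⟨mem_rootSpan_f ?_, fun β y hy => ?_⟩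
    · rw [neg_neg]
      exact (IsWord.gen i).mem
    · rw [neg_add_eq_sub]
      exact lie_f_mem_rootSpan H hy i
  | zero α =>
    refine ⟨zero_mem _, fun β y hy => ?_⟩
    rw [zero_lie]
    exact zero_mem _
  | add _ _ ihx ihy =>
    refine ⟨add_mem ihx.1 ihy.1, fun β y hy => ?_⟩
    rw [add_lie]
    exact add_mem (ihx.2 β y hy) (ihy.2 β y hy)
  | smul c _ ih =>
    refine ⟨Submodule.smul_mem _ _ ih.1, fun β y hy => ?_⟩
    rw [smul_lie]
    exact Submodule.smul_mem _ _ (ih.2 β y hy)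
  | @lie α β x y _ _ ihx ihy =>
    refine ⟨ihx.2 _ _ ihy.1, fun γ z hz => ?_⟩
    rw [lie_lie]
    refine sub_mem ?_ ?_
    · rw [add_assoc]
      exact ihx.2 _ _ (ihy.2 γ z hz)
    · rw [add_comm α β, add_assoc]
      exact ihy.2 _ _ (ihx.2 γ z hz)

variable (K A) in
/-- The homogeneous component of `g̃(A)` of degree `α`. -/
def tildeComponent (α : Fin n → ℤ) : Submodule K (GTilde K A) where
  carrier := {x | TildeHom K A α x}
  add_mem' := TildeHom.add
  zero_mem' := TildeHom.zero α
  smul_mem' c _ := TildeHom.smul c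

theorem lie_mem_iSup_tildeComponent {x y : GTilde K A} (hx : x ∈ ⨆ α, tildeComponent K A α)
    (hy : y ∈ ⨆ α, tildeComponent K A α) : ⁅x, y⁆ ∈ ⨆ α, tildeComponent K A α := by
  induction hx using Submodule.iSup_induction' with
  | mem α x hx =>
    induction hy using Submodule.iSup_induction' with
    | mem β y hy => exact Submodule.mem_iSup_of_mem (α + β) (TildeHom.lie hx hy)
    | zero =>
      rw [lie_zero (L := GTilde K A)]
      exact zero_mem _
    | add y z _ _ ihy ihz =>
      rw [LieRing.lie_add]
      exact add_mem ihy ihz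
  | zero =>
    rw [zero_lie]
    exact zero_mem _
  | add x z _ _ ihx ihz =>
    rw [add_lie]
    exact add_mem ihx ihz

/-- The algebra `g̃(A)` is spanned by homogeneous elements. -/
theorem iSup_tildeComponent : ⨆ α, tildeComponent K A α = ⊤ := by
  let S : LieSubalgebra K (GTilde K A) :=
    { (⨆ α, tildeComponent K A α : Submodule K (GTilde K A)) with
      lie_mem' := lie_mem_iSup_tildeComponent }
  have hS : S = ⊤ := lieSubalgebra_eq_top fun x => by
    cases x with
    | H i => exact Submodule.mem_iSup_of_mem (p := tildeComponent K A) 0 (TildeHom.h i)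
    | E i => exact Submodule.mem_iSup_of_mem (p := tildeComponent K A) _ (TildeHom.e i)
    | F i => exact Submodule.mem_iSup_of_mem (p := tildeComponent K A) _ (TildeHom.f i)
  have : S.toSubmodule = ⊤ := by rw [hS]; rfl
  exact this

theorem tilde_induction {p : GTilde K A → Prop} (hmem : ∀ α x, TildeHom K A α x → p x)
    (hadd : ∀ x y, p x → p y → p (x + y)) (x : GTilde K A) : p x :=
  Submodule.iSup_induction _ (motive := p) (by rw [iSup_tildeComponent]; trivial) hmem
    (hmem 0 0 (TildeHom.zero 0)) hadd

/-- A homogeneous element which the Harish-Chandra projection does not kill has degree zero and lies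
in the Cartan subalgebra. -/
theorem TildeHom.harishChandra_eq_zero_or {α : Fin n → ℤ} {x : GTilde K A}
    (hx : TildeHom K A α x) : harishChandra K A x = 0 ∨ α = 0 ∧ x ∈ tildeCartan K A := by
  rcases eq_or_ne α 0 with rfl | hα
  · right
    exact ⟨rfl, rootSpan_le (S := tildeCartan K A) (fun y hy => (hy.ne_zero rfl).elim)
      (fun y hy => (hy.ne_zero neg_zero).elim)
      (fun _ i => Submodule.subset_span (Set.mem_range_self i)) hx.mem_rootSpan⟩
  · left
    exact rootSpan_le (S := LinearMap.ker (harishChandra K A))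
      (fun y hy => harishChandra_word_e hy) (fun y hy => harishChandra_word_f hy)
      (fun h0 => (hα h0).elim) hx.mem_rootSpan

/-- The Harish-Chandra projection kills `r`. Hence `r`, too, meets the Cartan subalgebra
trivially. -/
theorem maximalIdeal_le_ker :
    (maximalIdeal K A).toSubmodule ≤ LinearMap.ker (harishChandra K A) := by
  rw [maximalIdeal, LieSubmodule.sSup_toSubmodule]
  refine sSup_le ?_
  rintro _ ⟨I, ⟨hI, hI0⟩, rfl⟩ x hx
  refine Submodule.span_le.2 ?_ (hI x hx)
  rintro y ⟨hyI, α, hy⟩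
  rcases hy.harishChandra_eq_zero_or with h | ⟨-, h⟩
  · exact h
  · rw [hI0 y hyI h]
    exact zero_mem _

theorem isGradedIdeal_maximalIdeal : IsGradedIdeal K A (maximalIdeal K A) := by
  intro x hx
  have hle : (maximalIdeal K A).toSubmodule ≤
      Submodule.span K {y : GTilde K A | y ∈ maximalIdeal K A ∧ ∃ α, TildeHom K A α y} := by
    conv_lhs => rw [maximalIdeal, LieSubmodule.sSup_toSubmodule]
    refine sSup_le ?_
    rintro _ ⟨I, hI, rfl⟩ x hx
    refine Submodule.span_mono ?_ (hI.1 x hx)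
    rintro y ⟨hy, hα⟩
    exact ⟨(le_sSup hI : I ≤ maximalIdeal K A) hy, hα⟩
  exact hle hx

theorem le_maximalIdeal {I : LieIdeal K (GTilde K A)} (hI : IsGradedIdeal K A I)
    (h0 : ∀ x ∈ I, harishChandra K A x = 0) : I ≤ maximalIdeal K A :=
  le_sSup ⟨hI, fun x hx hxh => eq_zero_of_mem_tildeCartan hxh (h0 x hx)⟩

/-- A subspace which is stable under `ad` of the generators of `g̃(A)` is an ideal. -/
def idealOfStable (J : Submodule K (GTilde K A))
    (hJ : ∀ x, ∀ y ∈ J, ⁅tildeGen K A x, y⁆ ∈ J) : LieIdeal K (GTilde K A) :=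
  { J with
    lie_mem := by
      intro x y hy
      let S : LieSubalgebra K (GTilde K A) :=
        { carrier := {u | ∀ y ∈ J, ⁅u, y⁆ ∈ J}
          add_mem' := fun {u v} hu hv y hy => by
            rw [add_lie]
            exact add_mem (hu y hy) (hv y hy)
          zero_mem' := fun y hy => by
            rw [zero_lie]
            exact zero_mem _
          smul_mem' := fun c u hu y hy => by
            rw [smul_lie]
            exact Submodule.smul_mem _ _ (hu y hy)
          lie_mem' := fun {u v} hu hv y hy => by
            rw [lie_lie]
            exact sub_mem (hu _ (hv y hy)) (hv _ (hu y hy)) }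
      have hS : x ∈ S := by
        rw [lieSubalgebra_eq_top (S := S) hJ]
        trivial
      exact hS y hy }

/-- `IsDescendant e x β γ y`: the element `y` is of the form `[eᵢ, [eⱼ, … [eₖ, x]]]`, and
`γ = β + αᵢ + ⋯ + αₖ`, where `β` is thought of as the degree of `x`. -/
inductive IsDescendant {L : Type*} [LieRing L] (e : Fin n → L) (x : L) (β : Fin n → ℤ) :
    (Fin n → ℤ) → L → Prop
  | base : IsDescendant e x β β x
  | lie (i : Fin n) {γ : Fin n → ℤ} {y : L} :
      IsDescendant e x β γ y → IsDescendant e x β (γ + Pi.single i 1) ⁅e i, y⁆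

theorem IsDescendant.mem_wordSpan {L : Type*} [LieRing L] [LieAlgebra K L] {e : Fin n → L} {x : L}
    {β γ : Fin n → ℤ} {y : L} (hy : IsDescendant e x β γ y) (hx : x ∈ wordSpan K e β) :
    y ∈ wordSpan K e γ := by
  induction hy with
  | base => exact hx
  | lie i _ ih => exact lie_mem_wordSpan ih i

/-- If an element `x` of positive degree of `g̃(A)` is mapped to `r` by all `ad fᵢ`, then it
belongs to `r`: the descendants of `x` together with `r` span a graded ideal in the kernel of the
Harish-Chandra projection. Here `(e, f, h)` is either the standard triple (with `s = 1`)
or the opposite one (with `s = -1`). -/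
theorem mem_maximalIdeal_of_lie_mem {e f h : Fin n → GTilde K A} (H : ChevalleyRel A e f h)
    (hgen : ∀ J : Submodule K (GTilde K A), (∀ i, ∀ y ∈ J, ⁅e i, y⁆ ∈ J) →
      (∀ i, ∀ y ∈ J, ⁅f i, y⁆ ∈ J) → (∀ i, ∀ y ∈ J, ⁅h i, y⁆ ∈ J) →
      ∀ x, ∀ y ∈ J, ⁅tildeGen K A x, y⁆ ∈ J)
    (s : ℤ) (hs : ∀ i, TildeHom K A (s • Pi.single i 1) (e i))
    (hc : ∀ β y, IsWord e β y → harishChandra K A y = 0)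
    {β : Fin n → ℤ} {x : GTilde K A} (hx : x ∈ wordSpan K e β)
    (hf : ∀ i, ⁅f i, x⁆ ∈ maximalIdeal K A) : x ∈ maximalIdeal K A := by
  set U : Submodule K (GTilde K A) :=
    Submodule.span K {y | ∃ γ, IsDescendant e x β γ y} with hU
  set J : Submodule K (GTilde K A) := (maximalIdeal K A).toSubmodule ⊔ U with hJ
  have hmemJ : ∀ {γ y}, IsDescendant e x β γ y → y ∈ J := fun {γ y} hy =>
    Submodule.mem_sup_right (Submodule.subset_span ⟨γ, hy⟩)
  have hstab : ∀ u : GTilde K A, (∀ γ y, IsDescendant e x β γ y → ⁅u, y⁆ ∈ J) →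
      ∀ y ∈ J, ⁅u, y⁆ ∈ J := by
    intro u hu y hy
    have hle : J ≤ J.comap (LieAlgebra.ad K (GTilde K A) u : GTilde K A →ₗ[K] GTilde K A) := by
      refine sup_le ?_ (Submodule.span_le.2 ?_)
      · intro z hz
        exact Submodule.mem_sup_left ((maximalIdeal K A).lie_mem hz)
      · rintro z ⟨γ, hz⟩
        exact hu γ z hz
    exact hle hy
  have he : ∀ i, ∀ y ∈ J, ⁅e i, y⁆ ∈ J := fun i => hstab _ fun γ y hy => hmemJ (hy.lie i)
  have hweight : ∀ i γ y, IsDescendant e x β γ y → ⁅h i, y⁆ ∈ J := fun i γ y hy => by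
    rw [lie_h_of_mem_wordSpan H (hy.mem_wordSpan hx)]
    exact zsmul_mem (hmemJ hy) _
  have hfJ : ∀ i, ∀ y ∈ J, ⁅f i, y⁆ ∈ J := fun i => hstab _ fun γ y hy => by
    induction hy with
    | base => exact Submodule.mem_sup_left (hf i)
    | lie k hy ih =>
      rw [leibniz_lie, H.fe]
      refine add_mem ?_ (he k _ ih)
      split_ifs
      · rw [neg_lie]
        exact neg_mem (hweight i _ _ hy)
      · rw [zero_lie]
        exact zero_mem _
  have hword : ∀ γ, wordSpan K e γ ≤ tildeComponent K A (s • γ) := fun γ =>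
    wordSpan_le fun y hy => by
      induction hy with
      | gen i => exact hs i
      | @lie i γ y hy ih =>
        rw [smul_add, add_comm]
        exact TildeHom.lie (hs i) ih
  have hle := le_maximalIdeal (I := idealOfStable J (hgen J he hfJ fun i => hstab _ (hweight i)))
    ?_ ?_
  · exact hle (hmemJ IsDescendant.base)
  · intro y hy
    have hle : J ≤ Submodule.span K {y : GTilde K A | y ∈ J ∧ ∃ α, TildeHom K A α y} := by
      refine sup_le (fun z hz => ?_) (Submodule.span_le.2 ?_)
      · refine Submodule.span_mono ?_ (isGradedIdeal_maximalIdeal z hz)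
        rintro w ⟨hw, hα⟩
        exact ⟨Submodule.mem_sup_left hw, hα⟩
      · rintro z ⟨γ, hz⟩
        exact Submodule.subset_span ⟨hmemJ hz, _, hword γ (hz.mem_wordSpan hx)⟩
    exact hle hy
  · intro y hy
    have hle : J ≤ LinearMap.ker (harishChandra K A) := by
      refine sup_le maximalIdeal_le_ker (Submodule.span_le.2 ?_)
      rintro z ⟨γ, hz⟩
      exact wordSpan_le (S := LinearMap.ker (harishChandra K A)) (hc γ) (hz.mem_wordSpan hx)
    exact hle hy

end Maximal

/-! ### Structure of `g(A)` -/

section Quotient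

open CartanMatrix

variable {K : Type*} [Field K] {n : ℕ} {A : Matrix (Fin n) (Fin n) ℤ}

section Map

variable {L M : Type*} [LieRing L] [LieAlgebra K L] [LieRing M] [LieAlgebra K M]

theorem ChevalleyRel.map {e f h : Fin n → L} (H : ChevalleyRel A e f h) (φ : L →ₗ⁅K⁆ M) :
    ChevalleyRel A (fun i => φ (e i)) (fun i => φ (f i)) (fun i => φ (h i)) where
  hh i j := by rw [← LieHom.map_lie, H.hh, map_zero]
  ef i j := by
    rw [← LieHom.map_lie, H.ef]
    split_ifs
    · rfl
    · rw [map_zero]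
  he i j := by rw [← LieHom.map_lie, H.he, map_zsmul]
  hf i j := by rw [← LieHom.map_lie, H.hf, map_neg, map_zsmul]

theorem IsWord.map {x : Fin n → L} {β : Fin n → ℤ} {y : L} (hy : IsWord x β y) (φ : L →ₗ⁅K⁆ M) :
    IsWord (fun i => φ (x i)) β (φ y) := by
  induction hy with
  | gen i => exact IsWord.gen (x := fun i => φ (x i)) i
  | lie i _ ih =>
    rw [LieHom.map_lie]
    exact ih.lie i

theorem IsWord.exists_lift {x : Fin n → L} {φ : L →ₗ⁅K⁆ M} {β : Fin n → ℤ} {y : M}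
    (hy : IsWord (fun i => φ (x i)) β y) : ∃ z, IsWord x β z ∧ φ z = y := by
  induction hy with
  | gen i => exact ⟨x i, IsWord.gen i, rfl⟩
  | lie i _ ih =>
    obtain ⟨z, hz, rfl⟩ := ih
    exact ⟨_, hz.lie i, LieHom.map_lie φ _ _⟩

theorem exists_lift_of_mem_wordSpan {x : Fin n → L} {φ : L →ₗ⁅K⁆ M} {β : Fin n → ℤ} {y : M}
    (hy : y ∈ wordSpan K (fun i => φ (x i)) β) : ∃ z ∈ wordSpan K x β, φ z = y := by
  have : wordSpan K (fun i => φ (x i)) β ≤ (wordSpan K x β).map (φ : L →ₗ[K] M) :=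
    wordSpan_le fun z hz => by
      obtain ⟨w, hw, rfl⟩ := hz.exists_lift
      exact ⟨w, hw.mem, rfl⟩
  exact this hy

theorem map_mem_rootSpan {e f h : Fin n → L} (φ : L →ₗ⁅K⁆ M) {β : Fin n → ℤ} {y : L}
    (hy : y ∈ rootSpan K e f h β) :
    φ y ∈ rootSpan K (fun i => φ (e i)) (fun i => φ (f i)) (fun i => φ (h i)) β := by
  refine rootSpan_le (S := (rootSpan K (fun i => φ (e i)) (fun i => φ (f i))
    (fun i => φ (h i)) β).comap (φ : L →ₗ[K] M)) (fun z hz => ?_) (fun z hz => ?_) ?_ hy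
  · exact mem_rootSpan_e (hz.map φ).mem
  · exact mem_rootSpan_f (hz.map φ).mem
  · rintro rfl i
    exact h_mem_rootSpan (h := fun i => φ (h i)) i

end Map

variable (K A) in
/-- The projection `g̃(A) → g(A)`. -/
def toContragredient : GTilde K A →ₗ⁅K⁆ Contragredient K A where
  toFun := LieSubmodule.Quotient.mk
  map_add' _ _ := rfl
  map_smul' _ _ := rfl
  map_lie' := rfl

theorem toContragredient_surjective : Function.Surjective (toContragredient K A) :=
  LieSubmodule.Quotient.surjective_mk' _

theorem toContragredient_eq_zero {x : GTilde K A} :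
    toContragredient K A x = 0 ↔ x ∈ maximalIdeal K A :=
  LieSubmodule.Quotient.mk_eq_zero'

variable (K A) in
/-- The element `hᵢ` of `g(A)`. -/
def h (i : Fin n) : Contragredient K A := toContragredient K A (tildeH K A i)

variable (K A) in
theorem chevalleyRel_contragredient : ChevalleyRel A (e K A) (f K A) (h K A) :=
  (chevalleyRel_tilde K A).map (toContragredient K A)

variable (K A) in
/-- The maximality of `r` makes the positive part of `g(A)` nondegenerate. -/
theorem nondegenerate_e : Nondegenerate K (e K A) (f K A) := by
  intro β x hx hf
  obtain ⟨x, hx', rfl⟩ := exists_lift_of_mem_wordSpan (x := tildeE K A)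
    (φ := toContragredient K A) hx
  rw [toContragredient_eq_zero]
  refine mem_maximalIdeal_of_lie_mem (chevalleyRel_tilde K A) ?_ 1 (fun i => ?_)
    (fun β y hy => harishChandra_word_e hy) hx' fun i => ?_
  · rintro J he hf hh (i | i | i)
    exacts [hh i, he i, hf i]
  · rw [one_smul]
    exact TildeHom.e i
  · rw [← toContragredient_eq_zero, LieHom.map_lie]
    exact hf i

variable (K A) in
theorem nondegenerate_f : Nondegenerate K (f K A) (e K A) := by
  intro β x hx hf
  obtain ⟨x, hx', rfl⟩ := exists_lift_of_mem_wordSpan (x := tildeF K A)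
    (φ := toContragredient K A) hx
  rw [toContragredient_eq_zero]
  refine mem_maximalIdeal_of_lie_mem (chevalleyRel_tilde K A).swap ?_ (-1) (fun i => ?_)
    (fun β y hy => harishChandra_word_f hy) hx' fun i => ?_
  · rintro J he hf hh (i | i | i)
    · intro y hy
      have := neg_mem (hh i y hy)
      rwa [Pi.neg_apply, neg_lie, neg_neg] at this
    exacts [hf i, he i]
  · rw [neg_one_smul]
    exact TildeHom.f i
  · rw [← toContragredient_eq_zero, LieHom.map_lie]
    exact hf i

variable (K A) in
theorem iSup_rootSpan_contragredient : ⨆ β, rootSpan K (e K A) (f K A) (h K A) β = ⊤ := by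
  rw [eq_top_iff]
  rintro x -
  obtain ⟨x, rfl⟩ := toContragredient_surjective x
  revert x
  refine tilde_induction (fun α x hx => ?_) fun x y hx hy => ?_
  · exact Submodule.mem_iSup_of_mem α (map_mem_rootSpan (toContragredient K A) hx.mem_rootSpan)
  · rw [map_add]
    exact add_mem hx hy

end Quotient

/-! ### Finiteness properties of `g(A)` -/

section FiniteType

variable (K : Type*) [Field K] {n : ℕ} (A : Matrix (Fin n) (Fin n) ℤ)

/-- The finiteness properties of `g(A)` used in the conjugacy argument: `g(A)` is
finite-dimensional, and the exponentials of `t ad eᵢ` and `t ad fᵢ` are automorphisms. -/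
structure IsFiniteType : Prop where
  finite : Module.Finite K (Contragredient K A)
  exp_e : ∀ i, IsExpNilpotent (e K A i)
  exp_f : ∀ i, IsExpNilpotent (f K A i)

variable {K A}

theorem IsSimplyLacedForm.isFiniteType {q : (Fin n → ℤ) → ℤ} (Q : IsSimplyLacedForm A q) :
    IsFiniteType K A where
  finite := finite_of_finite_degrees Q.finite (iSup_rootSpan_contragredient K A) fun _ hβ =>
    rootSpan_eq_bot_of_two_le (nondegenerate_e K A) (nondegenerate_f K A)
      (chevalleyRel_contragredient K A) Q (Int.lt_iff_add_one_le.1 (not_le.1 hβ))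
  exp_e := isExpNilpotent_e (nondegenerate_e K A) (nondegenerate_f K A)
    (chevalleyRel_contragredient K A) Q (iSup_rootSpan_contragredient K A)
  exp_f := isExpNilpotent_f (nondegenerate_e K A) (nondegenerate_f K A)
    (chevalleyRel_contragredient K A) Q (iSup_rootSpan_contragredient K A)

end FiniteType

/-! ### The quadratic forms of types `E₆`, `E₇`, `E₈` -/

section Forms

open Matrix

/-- The quadratic form `½ βᵀ A β` of type `E₆`. -/
def formE₆ (β : Fin 6 → ℤ) : ℤ :=
  β 0 ^ 2 + β 1 ^ 2 + β 2 ^ 2 + β 3 ^ 2 + β 4 ^ 2 + β 5 ^ 2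
    - β 0 * β 2 - β 1 * β 3 - β 2 * β 3 - β 3 * β 4 - β 4 * β 5

/-- The quadratic form `½ βᵀ A β` of type `E₇`. -/
def formE₇ (β : Fin 7 → ℤ) : ℤ :=
  β 0 ^ 2 + β 1 ^ 2 + β 2 ^ 2 + β 3 ^ 2 + β 4 ^ 2 + β 5 ^ 2 + β 6 ^ 2
    - β 0 * β 2 - β 1 * β 3 - β 2 * β 3 - β 3 * β 4 - β 4 * β 5 - β 5 * β 6

/-- The quadratic form `½ βᵀ A β` of type `E₈`. -/
def formE₈ (β : Fin 8 → ℤ) : ℤ :=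
  β 0 ^ 2 + β 1 ^ 2 + β 2 ^ 2 + β 3 ^ 2 + β 4 ^ 2 + β 5 ^ 2 + β 6 ^ 2 + β 7 ^ 2
    - β 0 * β 2 - β 1 * β 3 - β 2 * β 3 - β 3 * β 4 - β 4 * β 5 - β 5 * β 6 - β 6 * β 7

/-- Completing squares from the three ends of the diagram towards the branch node writes the form of
type `E₈` as a sum of squares with positive coefficients; this bounds all coordinates. The constant
`1000` is not optimal. -/
theorem sq_le_formE₈ (β : Fin 8 → ℤ) (i : Fin 8) : β i ^ 2 ≤ 1000 * formE₈ β := by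
  have key : 120 * formE₈ β = 30 * (2 * β 1 - β 3) ^ 2 + 30 * (2 * β 0 - β 2) ^ 2
      + 10 * (3 * β 2 - 2 * β 3) ^ 2 + 30 * (2 * β 7 - β 6) ^ 2 + 10 * (3 * β 6 - 2 * β 5) ^ 2
      + 5 * (4 * β 5 - 3 * β 4) ^ 2 + 3 * (5 * β 4 - 4 * β 3) ^ 2 + 2 * β 3 ^ 2 := by
    unfold formE₈
    ring
  -- The `hᵢ` are the squares in `key`; the `kᵢ` bound each coordinate in terms of such a square and
  -- the coordinate at the neighbour towards the branch node.
  have h1 := sq_nonneg (2 * β 1 - β 3)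
  have h2 := sq_nonneg (2 * β 0 - β 2)
  have h3 := sq_nonneg (3 * β 2 - 2 * β 3)
  have h4 := sq_nonneg (2 * β 7 - β 6)
  have h5 := sq_nonneg (3 * β 6 - 2 * β 5)
  have h6 := sq_nonneg (4 * β 5 - 3 * β 4)
  have h7 := sq_nonneg (5 * β 4 - 4 * β 3)
  have h8 := sq_nonneg (β 3)
  have k1 := sq_nonneg ((2 * β 1 - β 3) - β 3)
  have k2 := sq_nonneg ((2 * β 0 - β 2) - β 2)
  have k3 := sq_nonneg ((3 * β 2 - 2 * β 3) - 2 * β 3)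
  have k4 := sq_nonneg ((2 * β 7 - β 6) - β 6)
  have k5 := sq_nonneg ((3 * β 6 - 2 * β 5) - 2 * β 5)
  have k6 := sq_nonneg ((4 * β 5 - 3 * β 4) - 3 * β 4)
  have k7 := sq_nonneg ((5 * β 4 - 4 * β 3) - 4 * β 3)
  generalize formE₈ β = Q at key ⊢
  fin_cases i <;> simp only [Fin.zero_eta, Fin.mk_one, Fin.reduceFinMk] <;>
    ring_nf at key h1 h2 h3 h4 h5 h6 h7 h8 k1 k2 k3 k4 k5 k6 k7 ⊢ <;> linarith

theorem formE₇_eq (β : Fin 7 → ℤ) :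
    formE₇ β = formE₈ ![β 0, β 1, β 2, β 3, β 4, β 5, β 6, 0] := by
  simp [formE₇, formE₈]

theorem formE₆_eq (β : Fin 6 → ℤ) :
    formE₆ β = formE₈ ![β 0, β 1, β 2, β 3, β 4, β 5, 0, 0] := by
  simp [formE₆, formE₈]

theorem sq_le_formE₇ (β : Fin 7 → ℤ) (i : Fin 7) : β i ^ 2 ≤ 1000 * formE₇ β := by
  have := sq_le_formE₈ ![β 0, β 1, β 2, β 3, β 4, β 5, β 6, 0] i.castSucc
  rw [← formE₇_eq] at this
  fin_cases i <;> exact this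

theorem sq_le_formE₆ (β : Fin 6 → ℤ) (i : Fin 6) : β i ^ 2 ≤ 1000 * formE₆ β := by
  have := sq_le_formE₈ ![β 0, β 1, β 2, β 3, β 4, β 5, 0, 0] i.castSucc.castSucc
  rw [← formE₆_eq] at this
  fin_cases i <;> exact this

theorem pos_of_sq_le {n : ℕ} {q : (Fin n → ℤ) → ℤ} (hq : ∀ β i, β i ^ 2 ≤ 1000 * q β)
    {β : Fin n → ℤ} (hβ : β ≠ 0) : 1 ≤ q β := by
  obtain ⟨i, hi⟩ := Function.ne_iff.1 hβ
  have h1 := hq β i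
  have h2 : 0 < β i ^ 2 := sq_pos_of_ne_zero hi
  lia

theorem finite_of_sq_le {n : ℕ} {q : (Fin n → ℤ) → ℤ} (hq : ∀ β i, β i ^ 2 ≤ 1000 * q β) :
    {β | q β ≤ 1}.Finite := by
  refine (Set.finite_Icc (fun _ => -1000 : Fin n → ℤ) (fun _ => 1000)).subset fun β hβ => ?_
  have hβ' : q β ≤ 1 := hβ
  constructor <;> intro i <;> have := hq β i <;> nlinarith

theorem isSimplyLacedForm_E₆ : IsSimplyLacedForm CartanMatrix.E₆ formE₆ where
  zero := by simp [formE₆]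
  pos β := pos_of_sq_le sq_le_formE₆
  add_single β i := by
    fin_cases i <;>
      simp [formE₆, CartanMatrix.E₆, Matrix.mulVec, dotProduct, Fin.sum_univ_six] <;> ring
  neg β := by simp [formE₆]
  diag := by decide
  off_diag i := by fin_cases i <;> decide
  symm i := by fin_cases i <;> decide
  finite := finite_of_sq_le sq_le_formE₆

theorem isSimplyLacedForm_E₇ : IsSimplyLacedForm CartanMatrix.E₇ formE₇ where
  zero := by simp [formE₇]
  pos β := pos_of_sq_le sq_le_formE₇
  add_single β i := by
    fin_cases i <;>
      simp [formE₇, CartanMatrix.E₇, Matrix.mulVec, dotProduct, Fin.sum_univ_seven] <;> ring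
  neg β := by simp [formE₇]
  diag := by decide
  off_diag i := by fin_cases i <;> decide
  symm i := by fin_cases i <;> decide
  finite := finite_of_sq_le sq_le_formE₇

theorem isSimplyLacedForm_E₈ : IsSimplyLacedForm CartanMatrix.E₈ formE₈ where
  zero := by simp [formE₈]
  pos β := pos_of_sq_le sq_le_formE₈
  add_single β i := by
    fin_cases i <;>
      simp [formE₈, CartanMatrix.E₈, Matrix.mulVec, dotProduct, Fin.sum_univ_eight] <;> ring
  neg β := by simp [formE₈]
  diag := by decide
  off_diag i := by fin_cases i <;> decide
  symm i := by fin_cases i <;> decide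
  finite := finite_of_sq_le sq_le_formE₈

end Forms

/-! ### Folding -/

section Folding

open CartanMatrix

variable {K : Type*} [Field K] {m n : ℕ} {A : Matrix (Fin m) (Fin m) ℤ}
  {B : Matrix (Fin n) (Fin n) ℤ} {c : Fin m → Fin n}

/-- The sum of the `xᵢ` over the fibre of `c` at `k`. -/
def foldSum {M : Type*} [AddCommMonoid M] (c : Fin m → Fin n) (x : Fin m → M) (k : Fin n) : M :=
  ∑ i with c i = k, x i

theorem foldSum_add {M : Type*} [AddCommMonoid M] (x y : Fin m → M) :
    foldSum c (x + y) = foldSum c x + foldSum c y := by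
  funext k
  simp [foldSum, Finset.sum_add_distrib]

theorem foldSum_neg {M : Type*} [AddCommGroup M] (x : Fin m → M) :
    foldSum c (-x) = -foldSum c x := by
  funext k
  simp [foldSum]

theorem foldSum_zero {M : Type*} [AddCommMonoid M] : foldSum c (0 : Fin m → M) = 0 := by
  funext k
  simp [foldSum]

theorem foldSum_single (i : Fin m) :
    foldSum c (Pi.single i (1 : ℤ)) = Pi.single (c i) 1 := by
  funext k
  simp [foldSum, Pi.single_apply, eq_comm]

/-- Folding: if the column sums of `A` over the fibres of `c` are the entries of `B`, then the sums
of Chevalley generators for `A` over the fibres of `c` satisfy the relations for `B`. -/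
theorem ChevalleyRel.fold {L : Type*} [LieRing L] {e f h : Fin m → L} (H : ChevalleyRel A e f h)
    (hc : ∀ k j, ∑ i with c i = k, A i j = B k (c j)) :
    ChevalleyRel B (foldSum c e) (foldSum c f) (foldSum c h) where
  hh k l := by
    simp only [foldSum, sum_lie, lie_sum, H.hh, Finset.sum_const_zero]
  ef k l := by
    simp only [foldSum, sum_lie, lie_sum, H.ef, Finset.sum_ite_eq',
      Finset.mem_filter, Finset.mem_univ, true_and]
    split_ifs with hkl
    · subst hkl
      exact Finset.sum_congr rfl fun i hi => if_pos (Finset.mem_filter.1 hi).2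
    · exact Finset.sum_eq_zero fun i hi => if_neg fun h0 =>
        hkl (h0.symm.trans (Finset.mem_filter.1 hi).2)
  he k l := by
    simp only [foldSum, sum_lie, lie_sum, H.he, Finset.smul_sum]
    refine Finset.sum_congr rfl fun j hj => ?_
    rw [← Finset.sum_smul, hc, (Finset.mem_filter.1 hj).2]
  hf k l := by
    simp only [foldSum, sum_lie, lie_sum, H.hf, Finset.smul_sum]
    rw [← Finset.sum_neg_distrib]
    refine Finset.sum_congr rfl fun j hj => ?_
    rw [Finset.sum_neg_distrib, ← Finset.sum_smul, hc, (Finset.mem_filter.1 hj).2]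

variable (K) in
/-- The homomorphism `g̃(B) → g(A)` given by folding. -/
def foldHom (hc : ∀ k j, ∑ i with c i = k, A i j = B k (c j)) :
    GTilde K B →ₗ⁅K⁆ Contragredient K A :=
  tildeLift ((chevalleyRel_contragredient K A).fold hc)

variable {hc : ∀ k j, ∑ i with c i = k, A i j = B k (c j)}

variable (K A) in
/-- The part of `g(A)` of degree `γ` for the grading by `ℤⁿ` obtained from that by `ℤᵐ` by adding up
coordinates over the fibres of `c`. -/
def foldComponent (c : Fin m → Fin n) (γ : Fin n → ℤ) : Submodule K (Contragredient K A) :=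
  Submodule.span K {y | ∃ β x, foldSum c β = γ ∧ TildeHom K A β x ∧ toContragredient K A x = y}

theorem mem_foldComponent {β : Fin m → ℤ} {x : GTilde K A} (hx : TildeHom K A β x) :
    toContragredient K A x ∈ foldComponent K A c (foldSum c β) :=
  Submodule.subset_span ⟨β, x, rfl, hx, rfl⟩

theorem lie_mem_foldComponent {γ δ : Fin n → ℤ} {x y : Contragredient K A}
    (hx : x ∈ foldComponent K A c γ) (hy : y ∈ foldComponent K A c δ) :
    ⁅x, y⁆ ∈ foldComponent K A c (γ + δ) := by
  induction hx using Submodule.span_induction with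
  | mem x hx =>
    obtain ⟨β, x, rfl, hx, rfl⟩ := hx
    induction hy using Submodule.span_induction with
    | mem y hy =>
      obtain ⟨β', y, rfl, hy, rfl⟩ := hy
      rw [← LieHom.map_lie, ← foldSum_add]
      exact mem_foldComponent (hx.lie hy)
    | zero =>
      rw [lie_zero (L := Contragredient K A)]
      exact zero_mem _
    | add y z _ _ ihy ihz =>
      rw [LieRing.lie_add]
      exact add_mem ihy ihz
    | smul t y _ ih =>
      rw [LieAlgebra.lie_smul]
      exact Submodule.smul_mem _ _ ih
  | zero =>
    rw [zero_lie]
    exact zero_mem _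
  | add x z _ _ ihx ihz =>
    rw [add_lie]
    exact add_mem ihx ihz
  | smul t x _ ih =>
    rw [smul_lie]
    exact Submodule.smul_mem _ _ ih

theorem sum_mem_foldComponent {x : Fin m → GTilde K A} {β : Fin m → Fin m → ℤ} {γ : Fin n → ℤ}
    {k : Fin n} (hx : ∀ i, TildeHom K A (β i) (x i)) (hβ : ∀ i, c i = k → foldSum c (β i) = γ) :
    foldSum c (fun i => toContragredient K A (x i)) k ∈ foldComponent K A c γ := by
  refine sum_mem fun i hi => ?_
  rw [← hβ i (Finset.mem_filter.1 hi).2]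
  exact mem_foldComponent (hx i)

/-- Folding is compatible with the gradings. -/
theorem TildeHom.foldHom_mem {γ : Fin n → ℤ} {x : GTilde K B} (hx : TildeHom K B γ x) :
    foldHom K hc x ∈ foldComponent K A c γ := by
  induction hx with
  | h k =>
    rw [foldHom, tildeLift_gen]
    exact sum_mem_foldComponent TildeHom.h fun _ _ => foldSum_zero
  | e k =>
    rw [foldHom, tildeLift_gen]
    exact sum_mem_foldComponent TildeHom.e fun i hi => by rw [foldSum_single, hi]
  | f k =>
    rw [foldHom, tildeLift_gen]
    exact sum_mem_foldComponent TildeHom.f fun i hi => by rw [foldSum_neg, foldSum_single, hi]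
  | zero γ =>
    rw [map_zero]
    exact zero_mem _
  | add _ _ ihx ihy =>
    rw [map_add]
    exact add_mem ihx ihy
  | smul t _ ih =>
    rw [map_smul]
    exact Submodule.smul_mem _ _ ih
  | lie _ _ ihx ihy =>
    rw [LieHom.map_lie]
    exact lie_mem_foldComponent ihx ihy

/-- The homogeneous elements in the kernel of the folding homomorphism `g̃(B) → g(A)` are zero in
`g(B)`: they span a graded ideal, which meets the Cartan subalgebra trivially because the `hᵢ` are
linearly independent in `g(A)`. -/
theorem TildeHom.toContragredient_eq_zero_of_foldHom (hsurj : Function.Surjective c)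
    {γ : Fin n → ℤ} {x : GTilde K B} (hx : TildeHom K B γ x) (h0 : foldHom K hc x = 0) :
    toContragredient K B x = 0 := by
  rw [toContragredient_eq_zero]
  set S : Set (GTilde K B) := {y | (∃ γ, TildeHom K B γ y) ∧ foldHom K hc y = 0} with hS
  have hstab : ∀ u, ∀ y ∈ Submodule.span K S, ⁅tildeGen K B u, y⁆ ∈ Submodule.span K S := by
    intro u y hy
    have hu : ∃ δ, TildeHom K B δ (tildeGen K B u) := by
      cases u with
      | H i => exact ⟨_, TildeHom.h i⟩
      | E i => exact ⟨_, TildeHom.e i⟩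
      | F i => exact ⟨_, TildeHom.f i⟩
    obtain ⟨δ, hδ⟩ := hu
    have hle : Submodule.span K S ≤ (Submodule.span K S).comap
        (LieAlgebra.ad K (GTilde K B) (tildeGen K B u) : GTilde K B →ₗ[K] GTilde K B) := by
      refine Submodule.span_le.2 ?_
      rintro z ⟨⟨ε, hz⟩, hz0⟩
      refine Submodule.subset_span ⟨⟨δ + ε, hδ.lie hz⟩, ?_⟩
      rw [LieAlgebra.ad_apply, LieHom.map_lie, hz0, lie_zero]
    exact hle hy
  have hle : idealOfStable (Submodule.span K S) hstab ≤ maximalIdeal K B := by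
    refine le_sSup ⟨fun y hy => ?_, fun y hy hyh => ?_⟩
    · refine Submodule.span_mono ?_ (show y ∈ Submodule.span K S from hy)
      rintro z hz
      exact ⟨Submodule.subset_span hz, hz.1⟩
    · have hker : Submodule.span K S ≤
          LinearMap.ker (foldHom K hc : GTilde K B →ₗ[K] Contragredient K A) :=
        Submodule.span_le.2 fun z hz => hz.2
      have hy0 : foldHom K hc y = 0 := hker hy
      obtain ⟨t, rfl⟩ := mem_tildeCartan hyh
      have key : toContragredient K A (∑ i, t (c i) • tildeH K A i) = 0 := by
        rw [← hy0, map_sum, map_sum]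
        have hk : ∀ k, foldHom K hc (t k • tildeH K B k) =
            ∑ i with c i = k, toContragredient K A (t (c i) • tildeH K A i) := fun k => by
          rw [map_smul, foldHom, tildeLift_gen, genMap, foldSum, Finset.smul_sum]
          refine Finset.sum_congr rfl fun i hi => ?_
          rw [(Finset.mem_filter.1 hi).2, map_smul]
          rfl
        rw [Finset.sum_congr rfl fun k _ => hk k]
        exact (Finset.sum_fiberwise _ _ _).symm
      have ht := eq_zero_of_harishChandra_eq_zero
        (maximalIdeal_le_ker (toContragredient_eq_zero.1 key))
      refine Finset.sum_eq_zero fun k _ => ?_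
      obtain ⟨i, rfl⟩ := hsurj k
      rw [show t (c i) = 0 from congrFun ht i, zero_smul]
  exact hle (Submodule.subset_span ⟨⟨γ, hx⟩, h0⟩)

/-- The identities of `IsExpNilpotent` for a homogeneous element descend along
`g̃(B) → g(A)`, `g̃(B) → g(B)`, since they can be tested on homogeneous elements. -/
theorem isExpNilpotent_of_foldHom (hsurj : Function.Surjective c) {δ : Fin n → ℤ}
    {u : GTilde K B} (hu : TildeHom K B δ u) (hexp : IsExpNilpotent (foldHom K hc u)) :
    IsExpNilpotent (toContragredient K B u) := by
  have hsmul : ∀ z : Contragredient K B, ∃ y, toContragredient K B y = z :=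
    toContragredient_surjective
  refine ⟨fun y => ?_, fun y z => ?_, fun y z => ?_⟩
  · obtain ⟨y, rfl⟩ := hsmul y
    induction y using tilde_induction with
    | hmem α y hy =>
      simp only [← LieHom.map_lie]
      refine (hu.lie (hu.lie (hu.lie hy))).toContragredient_eq_zero_of_foldHom (hc := hc) hsurj ?_
      simp only [LieHom.map_lie, hexp.cube]
    | hadd x y hx hy => simp only [map_add, LieRing.lie_add, hx, hy, add_zero]
  · obtain ⟨y, rfl⟩ := hsmul y
    obtain ⟨z, rfl⟩ := hsmul z
    induction y using tilde_induction with
    | hmem α y hy =>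
      induction z using tilde_induction with
      | hmem β z hz =>
        simp only [← LieHom.map_lie, ← map_add]
        have h1 := (hu.lie hy).lie (hu.lie (hu.lie hz))
        have h2 := (hu.lie (hu.lie hy)).lie (hu.lie hz)
        rw [show δ + (δ + α) + (δ + β) = δ + α + (δ + (δ + β)) by abel] at h2
        refine (h1.add h2).toContragredient_eq_zero_of_foldHom (hc := hc) hsurj ?_
        simp only [map_add, LieHom.map_lie, hexp.mixed]
      | hadd z w hz hw =>
        simp only [map_add, LieRing.lie_add]
        rw [add_add_add_comm, hz, hw, add_zero]
    | hadd x y hx hy =>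
      simp only [map_add, LieRing.lie_add, LieRing.add_lie]
      rw [add_add_add_comm, hx, hy, add_zero]
  · obtain ⟨y, rfl⟩ := hsmul y
    obtain ⟨z, rfl⟩ := hsmul z
    induction y using tilde_induction with
    | hmem α y hy =>
      induction z using tilde_induction with
      | hmem β z hz =>
        simp only [← LieHom.map_lie]
        refine ((hu.lie (hu.lie hy)).lie (hu.lie (hu.lie hz))).toContragredient_eq_zero_of_foldHom
          (hc := hc) hsurj ?_
        simp only [LieHom.map_lie, hexp.top]
      | hadd z w hz hw => simp only [map_add, LieRing.lie_add, hz, hw, add_zero]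
    | hadd x y hx hy => simp only [map_add, LieRing.lie_add, LieRing.add_lie, hx, hy, add_zero]

/-- The components of `g(B)` are the images of those of `g̃(B)`. -/
theorem exists_tildeHom_of_mem_rootSpan {γ : Fin n → ℤ} {y : Contragredient K B}
    (hy : y ∈ rootSpan K (e K B) (f K B) (h K B) γ) :
    ∃ x, TildeHom K B γ x ∧ toContragredient K B x = y := by
  have hE : ∀ {β z}, IsWord (tildeE K B) β z → TildeHom K B β z := fun {β z} hz => by
    induction hz with
    | gen i => exact TildeHom.e i
    | lie i _ ih =>
      rw [add_comm]
      exact (TildeHom.e i).lie ih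
  have hF : ∀ {β z}, IsWord (tildeF K B) β z → TildeHom K B (-β) z := fun {β z} hz => by
    induction hz with
    | gen i => exact TildeHom.f i
    | lie i _ ih =>
      rw [neg_add, add_comm]
      exact (TildeHom.f i).lie ih
  have hle : rootSpan K (e K B) (f K B) (h K B) γ ≤
      (tildeComponent K B γ).map (toContragredient K B : GTilde K B →ₗ[K] Contragredient K B) := by
    refine rootSpan_le (fun z hz => ?_) (fun z hz => ?_) ?_
    · obtain ⟨w, hw, rfl⟩ := IsWord.exists_lift (x := tildeE K B) (φ := toContragredient K B) hz
      exact ⟨w, hE hw, rfl⟩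
    · obtain ⟨w, hw, rfl⟩ := IsWord.exists_lift (x := tildeF K B) (φ := toContragredient K B) hz
      have := hF hw
      rw [neg_neg] at this
      exact ⟨w, this, rfl⟩
    · rintro rfl i
      exact ⟨tildeH K B i, TildeHom.h i, rfl⟩
  obtain ⟨x, hx, rfl⟩ := hle hy
  exact ⟨x, hx, rfl⟩

/-- If `g(A)` has finitely many degrees, then so does its folding `g(B)`. -/
theorem IsSimplyLacedForm.finite_of_fold {q : (Fin m → ℤ) → ℤ} (Q : IsSimplyLacedForm A q)
    (hc : ∀ k j, ∑ i with c i = k, A i j = B k (c j)) (hsurj : Function.Surjective c) :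
    Module.Finite K (Contragredient K B) := by
  refine finite_of_finite_degrees (Q.finite.image (foldSum c)) (iSup_rootSpan_contragredient K B)
    fun γ hγ => le_bot_iff.1 fun y hy => ?_
  obtain ⟨x, hx, rfl⟩ := exists_tildeHom_of_mem_rootSpan hy
  refine hx.toContragredient_eq_zero_of_foldHom (hc := hc) hsurj ?_
  have hbot : foldComponent K A c γ ≤ ⊥ := by
    refine Submodule.span_le.2 ?_
    rintro _ ⟨β, z, rfl, hz, rfl⟩
    have h1 := map_mem_rootSpan (toContragredient K A) hz.mem_rootSpan
    have h2 : 2 ≤ q β := by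
      by_contra h0
      exact hγ ⟨β, by change q β ≤ 1; lia, rfl⟩
    have h3 := rootSpan_eq_bot_of_two_le (nondegenerate_e K A) (nondegenerate_f K A)
      (chevalleyRel_contragredient K A) Q h2
    exact h3.le h1
  exact hbot hx.foldHom_mem

end Folding

/-! ### Type `F₄` as a folding of `E₆` -/

section F4

variable {K L : Type*} [Field K] [CharP K 3] [LieRing L] [LieAlgebra K L] {n : ℕ}
  {A : Matrix (Fin n) (Fin n) ℤ} {e f h : Fin n → L} {q : (Fin n → ℤ) → ℤ}

/-- For orthogonal simple roots, `eᵢ + eⱼ` can be exponentiated. -/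
theorem isExpNilpotent_add (N : Nondegenerate K e f) (N' : Nondegenerate K f e)
    (H : ChevalleyRel A e f h) (Q : IsSimplyLacedForm A q) (hT : ⨆ β, rootSpan K e f h β = ⊤)
    {i j : Fin n} (hij : A i j = 0) : IsExpNilpotent (e i + e j) := by
  have hji : A j i = 0 := by rw [Q.symm, hij]
  have hcomm := N.lie_eq_zero H hij hji
  have hcomm' : ∀ y : L, ⁅e i, ⁅e j, y⁆⁆ = ⁅e j, ⁅e i, y⁆⁆ := fun y => by
    rw [leibniz_lie, hcomm, zero_lie, zero_add]
  refine IsExpNilpotent.add (K := K) (isExpNilpotent_e N N' H Q hT i)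
    (isExpNilpotent_e N N' H Q hT j) hcomm (lie_lie_e_lie_e_eq_zero N N' H Q hT hij) fun y => ?_
  rw [hcomm', hcomm', lie_lie_e_lie_e_eq_zero N N' H Q hT hji]

/-- The folding of the Dynkin diagram of type `E₆` onto that of type `F₄` (in the numbering of
`CartanMatrix`): the nodes `0, 5` and `2, 4` are identified. -/
def foldE₆ : Fin 6 → Fin 4 := ![0, 3, 1, 2, 1, 0]

theorem foldE₆_cartan (k : Fin 4) (j : Fin 6) :
    ∑ i with foldE₆ i = k, CartanMatrix.E₆ i j = CartanMatrix.F₄ k (foldE₆ j) := by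
  revert k j
  decide

theorem foldE₆_surjective : Function.Surjective foldE₆ := by decide

theorem isExpNilpotent_foldSum {e f h : Fin 6 → L} (N : Nondegenerate K e f)
    (N' : Nondegenerate K f e) (H : ChevalleyRel CartanMatrix.E₆ e f h)
    (hT : ⨆ β, rootSpan K e f h β = ⊤) (k : Fin 4) : IsExpNilpotent (foldSum foldE₆ e k) := by
  have Q := isSimplyLacedForm_E₆
  fin_cases k
  · have : foldSum foldE₆ e 0 = e 0 + e 5 := by
      rw [foldSum, show Finset.univ.filter (fun i => foldE₆ i = 0) = {0, 5} by decide,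
        Finset.sum_pair (by decide)]
    exact this ▸ isExpNilpotent_add N N' H Q hT (by decide)
  · have : foldSum foldE₆ e 1 = e 2 + e 4 := by
      rw [foldSum, show Finset.univ.filter (fun i => foldE₆ i = 1) = {2, 4} by decide,
        Finset.sum_pair (by decide)]
    exact this ▸ isExpNilpotent_add N N' H Q hT (by decide)
  · have : foldSum foldE₆ e 2 = e 3 := by
      rw [foldSum, show Finset.univ.filter (fun i => foldE₆ i = 2) = {3} by decide,
        Finset.sum_singleton]
    exact this ▸ isExpNilpotent_e N N' H Q hT 3
  · have : foldSum foldE₆ e 3 = e 1 := by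
      rw [foldSum, show Finset.univ.filter (fun i => foldE₆ i = 3) = {1} by decide,
        Finset.sum_singleton]
    exact this ▸ isExpNilpotent_e N N' H Q hT 1

variable (K) in
theorem isFiniteType_F₄ : IsFiniteType K CartanMatrix.F₄ where
  finite := isSimplyLacedForm_E₆.finite_of_fold foldE₆_cartan foldE₆_surjective
  exp_e k := isExpNilpotent_of_foldHom (hc := foldE₆_cartan) foldE₆_surjective (TildeHom.e k) (by
    rw [foldHom, tildeLift_gen]
    exact isExpNilpotent_foldSum (nondegenerate_e K _) (nondegenerate_f K _)
      (chevalleyRel_contragredient K _) (iSup_rootSpan_contragredient K _) k)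
  exp_f k := isExpNilpotent_of_foldHom (hc := foldE₆_cartan) foldE₆_surjective (TildeHom.f k) (by
    rw [foldHom, tildeLift_gen]
    exact isExpNilpotent_foldSum (nondegenerate_f K _) (nondegenerate_e K _)
      (chevalleyRel_contragredient K _).swap
      (iSup_rootSpan_swap (iSup_rootSpan_contragredient K _)) k)

end F4

/-! ### Legal recolorings and the adjoint group -/

section Adjoint

variable {K : Type*} [Field K] {n : ℕ} {A : Matrix (Fin n) (Fin n) ℤ}

/-- The automorphisms of `g(A)` in the adjoint group. -/
def IsAdjoint (φ : Contragredient K A ≃ₗ⁅K⁆ Contragredient K A) : Prop :=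
  φ.toLinearEquiv ∈ adjointGroup K A

theorem IsAdjoint.trans {φ ψ : Contragredient K A ≃ₗ⁅K⁆ Contragredient K A} (hφ : IsAdjoint φ)
    (hψ : IsAdjoint ψ) : IsAdjoint (φ.trans ψ) :=
  (adjointGroup K A).mul_mem hψ hφ

theorem IsAdjoint.symm {φ : Contragredient K A ≃ₗ⁅K⁆ Contragredient K A} (hφ : IsAdjoint φ) :
    IsAdjoint φ.symm :=
  (adjointGroup K A).inv_mem hφ

theorem isAdjoint_refl :
    IsAdjoint (LieEquiv.refl : Contragredient K A ≃ₗ⁅K⁆ Contragredient K A) :=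
  (adjointGroup K A).one_mem

end Adjoint

section Exceptional

variable {K : Type*} [Field K] [CharP K 3] {n : ℕ} {A : Matrix (Fin n) (Fin n) ℤ}

theorem IsExceptional.isFiniteType (hA : IsExceptional A) : IsFiniteType K A := by
  cases hA with
  | F₄ => exact isFiniteType_F₄ K
  | E₆ => exact isSimplyLacedForm_E₆.isFiniteType
  | E₇ => exact isSimplyLacedForm_E₇.isFiniteType
  | E₈ => exact isSimplyLacedForm_E₈.isFiniteType

theorem IsExceptional.apply_eq_zero_comm (hA : IsExceptional A) {i j : Fin n} (h : A i j = 0) :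
    A j i = 0 := by
  cases hA with
  | F₄ => revert h; fin_cases i <;> fin_cases j <;> decide
  | E₆ => rwa [isSimplyLacedForm_E₆.symm]
  | E₇ => rwa [isSimplyLacedForm_E₇.symm]
  | E₈ => rwa [isSimplyLacedForm_E₈.symm]

theorem IsExceptional.diag (hA : IsExceptional A) (i : Fin n) : A i i = 2 := by
  cases hA with
  | F₄ => fin_cases i <;> decide
  | E₆ => exact isSimplyLacedForm_E₆.diag i
  | E₇ => exact isSimplyLacedForm_E₇.diag i
  | E₈ => exact isSimplyLacedForm_E₈.diag i

theorem Independent.apply_eq_zero {I : Finset (Fin n)} (hI : Independent A I) {i j : Fin n}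
    (hi : i ∈ I) (hj : j ∈ I) (hij : i ≠ j) : A i j = 0 := by
  by_contra h
  exact hI i hi j hj ⟨hij, h⟩

/-- In characteristic three, cubes of commuting operators `ad xᵢ` add up. -/
theorem lie_lie_lie_sum_eq_zero {L ι : Type*} [LieRing L] [LieAlgebra K L] (s : Finset ι)
    (x : ι → L) (hx : ∀ i ∈ s, ∀ y : L, ⁅x i, ⁅x i, ⁅x i, y⁆⁆⁆ = 0)
    (hcomm : ∀ i ∈ s, ∀ j ∈ s, ⁅x i, x j⁆ = 0) (y : L) :
    ⁅∑ i ∈ s, x i, ⁅∑ i ∈ s, x i, ⁅∑ i ∈ s, x i, y⁆⁆⁆ = 0 := by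
  classical
  induction s using Finset.induction_on generalizing y with
  | empty => simp
  | insert i s hi ih =>
    have h3 : (3 : K) = 0 := by exact_mod_cast CharP.cast_eq_zero K 3
    have ih' := ih (fun j hj => hx j (Finset.mem_insert_of_mem hj)) fun j hj k hk =>
      hcomm j (Finset.mem_insert_of_mem hj) k (Finset.mem_insert_of_mem hk)
    have hc : ⁅x i, ∑ j ∈ s, x j⁆ = 0 := by
      rw [lie_sum]
      exact Finset.sum_eq_zero fun j hj =>
        hcomm i (Finset.mem_insert_self i s) j (Finset.mem_insert_of_mem hj)
    have hi3 := hx i (Finset.mem_insert_self i s)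
    rw [Finset.sum_insert hi]
    generalize ∑ j ∈ s, x j = b at hc ih' ⊢
    have hswap : ∀ z : L, ⁅x i, ⁅b, z⁆⁆ = ⁅b, ⁅x i, z⁆⁆ := fun z => by
      rw [leibniz_lie, hc, zero_lie, zero_add]
    have h3' : ∀ z : L, z + (z + z) = 0 := fun z => by
      calc z + (z + z) = (3 : K) • z := by module
        _ = 0 := by rw [h3, zero_smul]
    calc ⁅x i + b, ⁅x i + b, ⁅x i + b, y⁆⁆⁆
        = (⁅b, ⁅x i, ⁅x i, y⁆⁆⁆ + (⁅b, ⁅x i, ⁅x i, y⁆⁆⁆ + ⁅b, ⁅x i, ⁅x i, y⁆⁆⁆)) +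
          (⁅b, ⁅b, ⁅x i, y⁆⁆⁆ + (⁅b, ⁅b, ⁅x i, y⁆⁆⁆ + ⁅b, ⁅b, ⁅x i, y⁆⁆⁆)) := by
          simp only [add_lie, lie_add, hswap, hi3, ih']
          abel
      _ = 0 := by rw [h3', h3', add_zero]

theorem lie_lie_lie_eSum (hA : IsExceptional A) {I : Finset (Fin n)} (hI : Independent A I)
    (y : Contragredient K A) : ⁅eSum K A I, ⁅eSum K A I, ⁅eSum K A I, y⁆⁆⁆ = 0 := by
  refine lie_lie_lie_sum_eq_zero (K := K) I (e K A)
    (fun i _ => (hA.isFiniteType.exp_e i).cube) (fun i hi j hj => ?_) y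
  rcases eq_or_ne i j with rfl | hij
  · exact lie_self _
  · have h0 := hI.apply_eq_zero hi hj hij
    exact (nondegenerate_e K A).lie_eq_zero (chevalleyRel_contragredient K A) h0
      (hA.apply_eq_zero_comm h0)

theorem isInRepAlpha3_of_cube (hA : IsExceptional A) {x : Contragredient K A}
    (hx : ∀ y : Contragredient K A, ⁅x, ⁅x, ⁅x, y⁆⁆⁆ = 0) :
    IsInRepAlpha3 (LieDerivation.ad K (Contragredient K A) x) where
  finite := hA.isFiniteType.finite
  cube_eq_zero := by
    refine LinearMap.ext fun y => ?_
    rw [pow_succ, pow_two, Module.End.mul_apply, Module.End.mul_apply, LieDerivation.coeFn_coe,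
      LieDerivation.ad_apply_apply, LieDerivation.ad_apply_apply, LieDerivation.ad_apply_apply, hx,
      LinearMap.zero_apply]

theorem isAdjoint_expEquiv {x : Contragredient K A} (hx : IsExpNilpotent x) {i : Fin n}
    (hxi : x = e K A i ∨ x = f K A i) (t : K) :
    IsAdjoint (expEquiv (two_ne_zero_of_charP_three K) hx t) :=
  Subgroup.subset_closure ⟨i, t, x, hxi, fun _ => rfl⟩

/-- For simple roots connected by a single edge, the product
`exp (ad eᵢ) exp (-ad fᵢ) exp (-ad fⱼ) exp (ad eⱼ)` maps `eᵢ` to `eⱼ`, through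
`eᵢ ↦ eᵢ + [eⱼ, eᵢ] ↦ [eⱼ, eᵢ] ↦ [eⱼ, eᵢ] + eⱼ ↦ eⱼ`. It fixes every vector that commutes with
`eᵢ`, `fᵢ`, `eⱼ`, `fⱼ`. -/
theorem exists_isAdjoint_of_singleEdge (hA : IsExceptional A) {i j : Fin n} (hij : i ≠ j)
    (hs : SingleEdge A i j) : ∃ φ : Contragredient K A ≃ₗ⁅K⁆ Contragredient K A, IsAdjoint φ ∧
      φ (e K A i) = e K A j ∧ ∀ y : Contragredient K A, ⁅e K A i, y⁆ = 0 →
        ⁅f K A i, y⁆ = 0 → ⁅e K A j, y⁆ = 0 → ⁅f K A j, y⁆ = 0 → φ y = y := by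
  have h2 := two_ne_zero_of_charP_three K
  have F : IsFiniteType K A := hA.isFiniteType
  have H := chevalleyRel_contragredient K A
  have N := nondegenerate_e K A
  have hjji : ⁅e K A j, ⁅e K A j, e K A i⁆⁆ = 0 := N.lie_lie_eq_zero H (hA.diag j) hs.2 hs.1
  have hiij : ⁅e K A i, ⁅e K A i, e K A j⁆⁆ = 0 := N.lie_lie_eq_zero H (hA.diag i) hs.1 hs.2
  have hfjei : ⁅f K A j, e K A i⁆ = 0 := by rw [H.fe, if_neg hij.symm]
  have hfiej : ⁅f K A i, e K A j⁆ = 0 := by rw [H.fe, if_neg hij]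
  have hfjx : ⁅f K A j, ⁅e K A j, e K A i⁆⁆ = e K A i := by
    rw [leibniz_lie, H.fe, if_pos rfl, hfjei, lie_zero, add_zero, neg_lie, H.he, hs.2, neg_smul,
      one_smul, neg_neg]
  have hfix : ⁅f K A i, ⁅e K A j, e K A i⁆⁆ = -e K A j := by
    rw [leibniz_lie, hfiej, zero_lie, zero_add, H.fe, if_pos rfl, lie_neg, lie_skew, H.he, hs.1,
      neg_smul, one_smul]
  refine ⟨(((expEquiv h2 (F.exp_e j) (1 : K)).trans (expEquiv h2 (F.exp_f j) (-1 : K))).trans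
    (expEquiv h2 (F.exp_f i) (-1 : K))).trans (expEquiv h2 (F.exp_e i) (1 : K)),
    (((isAdjoint_expEquiv _ (Or.inl rfl) _).trans (isAdjoint_expEquiv _ (Or.inr rfl) _)).trans
      (isAdjoint_expEquiv _ (Or.inr rfl) _)).trans (isAdjoint_expEquiv _ (Or.inl rfl) _), ?_, ?_⟩
  · have s1 : expEquiv h2 (F.exp_e j) (1 : K) (e K A i) = e K A i + ⁅e K A j, e K A i⁆ := by
      rw [expEquiv_apply_of_lie_lie_eq_zero h2 _ _ hjji, one_smul]
    have s2 : expEquiv h2 (F.exp_f j) (-1 : K) (e K A i + ⁅e K A j, e K A i⁆) =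
        ⁅e K A j, e K A i⁆ := by
      rw [expEquiv_apply_of_lie_lie_eq_zero h2 _ _ (by rw [lie_add, hfjei, hfjx, zero_add, hfjei]),
        lie_add, hfjei, hfjx, zero_add, neg_smul, one_smul]
      abel
    have s3 : expEquiv h2 (F.exp_f i) (-1 : K) ⁅e K A j, e K A i⁆ =
        ⁅e K A j, e K A i⁆ + e K A j := by
      rw [expEquiv_apply_of_lie_lie_eq_zero h2 _ _ (by rw [hfix, lie_neg, hfiej, neg_zero]), hfix,
        neg_smul, one_smul, neg_neg]
    have hiji : ⁅e K A i, ⁅e K A j, e K A i⁆⁆ = 0 := by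
      rw [← lie_skew (e K A j), lie_neg, hiij, neg_zero]
    have s4 : expEquiv h2 (F.exp_e i) (1 : K) (⁅e K A j, e K A i⁆ + e K A j) = e K A j := by
      rw [expEquiv_apply_of_lie_lie_eq_zero h2 _ _ (by rw [lie_add, hiji, zero_add, hiij]),
        lie_add, hiji, zero_add, one_smul, ← lie_skew (e K A j)]
      abel
    simp only [LieEquiv.trans_apply, s1, s2, s3, s4]
  · intro y h1 h2 h3 h4
    simp only [LieEquiv.trans_apply, expEquiv_apply_of_lie_eq_zero _ _ _ h3,
      expEquiv_apply_of_lie_eq_zero _ _ _ h4, expEquiv_apply_of_lie_eq_zero _ _ _ h2,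
      expEquiv_apply_of_lie_eq_zero _ _ _ h1]

/-- A legal swap of `i` and `j` moves `eᵢ` to `eⱼ` and fixes the `eₖ` of the other black nodes `k`,
which are adjacent neither to `i` nor to `j`. -/
theorem LegalSwap.exists_isAdjoint (hA : IsExceptional A) {I J : Finset (Fin n)}
    (h : LegalSwap A I J) : ∃ φ : Contragredient K A ≃ₗ⁅K⁆ Contragredient K A, IsAdjoint φ ∧
      φ (eSum K A I) = eSum K A J := by
  obtain ⟨hI, i, hi, j, hj, hs, hadj, rfl⟩ := h
  have H := chevalleyRel_contragredient K A
  have N := nondegenerate_e K A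
  obtain ⟨φ, hφ, hij, hfix⟩ := exists_isAdjoint_of_singleEdge (K := K) hA
    (by rintro rfl; exact hj hi) hs
  refine ⟨φ, hφ, ?_⟩
  rw [eSum, eSum, ← Finset.add_sum_erase I _ hi, Finset.sum_insert fun h0 =>
    hj (Finset.mem_of_mem_erase h0), map_add, hij, map_sum]
  congr 1
  refine Finset.sum_congr rfl fun k hk => ?_
  obtain ⟨hki, hkI⟩ := Finset.mem_erase.1 hk
  have hkj : k ≠ j := by rintro rfl; exact hj hkI
  have hik := hI.apply_eq_zero hi hkI hki.symm
  have hkj0 : A k j = 0 := by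
    by_contra h0
    exact hki (hadj k hkI ⟨hkj, h0⟩)
  refine hfix _ ?_ ?_ ?_ ?_
  · exact N.lie_eq_zero H hik (hA.apply_eq_zero_comm hik)
  · rw [H.fe, if_neg hki.symm]
  · exact N.lie_eq_zero H (hA.apply_eq_zero_comm hkj0) hkj0
  · rw [H.fe, if_neg hkj.symm]

theorem LegalRecoloring.exists_isAdjoint (hA : IsExceptional A) {I J : Finset (Fin n)}
    (h : LegalRecoloring A I J) : ∃ φ : Contragredient K A ≃ₗ⁅K⁆ Contragredient K A, IsAdjoint φ ∧
      φ (eSum K A I) = eSum K A J := by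
  induction h with
  | rel I J h => exact h.exists_isAdjoint hA
  | refl I => exact ⟨LieEquiv.refl, isAdjoint_refl, rfl⟩
  | symm I J _ ih =>
    obtain ⟨φ, hφ, hIJ⟩ := ih
    exact ⟨φ.symm, hφ.symm, by rw [← hIJ, LieEquiv.symm_apply_apply]⟩
  | trans I J M _ _ ih ih' =>
    obtain ⟨φ, hφ, hIJ⟩ := ih
    obtain ⟨ψ, hψ, hJM⟩ := ih'
    exact ⟨φ.trans ψ, hφ.trans hψ, by rw [LieEquiv.trans_apply, hIJ, hJM]⟩

end Exceptional

end ExcLie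

end

theorem mainTheorem4 {K : Type*} [Field K] [IsAlgClosed K] [CharP K 3]
    {n : ℕ} (A : Matrix (Fin n) (Fin n) ℤ) (hA : ExcLie.IsExceptional A)
    (I J : Finset (Fin n)) (hI : ExcLie.Independent A I)
    (hσ : ExcLie.LegalRecoloring A I J) :
    (∃ (hd : ExcLie.IsInRepAlpha3
          (LieDerivation.ad K (ExcLie.Contragredient K A) (ExcLie.eSum K A I)))
        (hd' : ExcLie.IsInRepAlpha3
          (LieDerivation.ad K (ExcLie.Contragredient K A) (ExcLie.eSum K A J))),
      Nonempty (ExcLie.LieSuperalgebra.Iso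
        (ExcLie.semisimplification _ hd) (ExcLie.semisimplification _ hd'))) ∧
    ∃ φ : ExcLie.Contragredient K A ≃ₗ⁅K⁆ ExcLie.Contragredient K A,
      φ.toLinearEquiv ∈ ExcLie.adjointGroup K A ∧
        φ (ExcLie.eSum K A I) = ExcLie.eSum K A J := by
  obtain ⟨φ, hφ, hIJ⟩ := ExcLie.LegalRecoloring.exists_isAdjoint (K := K) hA hσ
  have hcube : ∀ y : ExcLie.Contragredient K A,
      ⁅ExcLie.eSum K A I, ⁅ExcLie.eSum K A I, ⁅ExcLie.eSum K A I, y⁆⁆⁆ = 0 :=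
    ExcLie.lie_lie_lie_eSum hA hI
  refine ⟨⟨ExcLie.isInRepAlpha3_of_cube hA hcube, ExcLie.isInRepAlpha3_of_cube hA fun y => ?_,
    ExcLie.nonempty_semisimplification_iso _ _ φ fun x => ?_⟩, φ, hφ, hIJ⟩
  · obtain ⟨z, rfl⟩ : ∃ z, φ z = y := φ.surjective y
    rw [← hIJ, ← LieEquiv.map_lie, ← LieEquiv.map_lie, ← LieEquiv.map_lie, hcube, map_zero]
  · rw [LieDerivation.ad_apply_apply, LieDerivation.ad_apply_apply, LieEquiv.map_lie, hIJ]
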